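/- **Setting.** Let $S,d\ge 0$ and $T\ge 1$ be integers. Tokens lie in $\mathsf X=\{0,\dots,K-1\}$, $K\ge1$, with mask token $m=K-1$, identified with one-hot vectors of $\mathbb R^K$; $\mathsf Y=\mathbb R^d$ and $\mathsf Z=\mathsf X^S\times\mathsf Y$. Let $q_0$ be a probability distribution on $\mathsf X^S$. Schedules: $\gamma_t\in[0,1]$, $\alpha_t\ge0$, $\sigma_t>0$ for $1\le t\le T$; put $\bar\gamma_t=\prod_{s\le t}\gamma_s$, $\bar\alpha_t=\prod_{s\le t}\alpha_s$, $\bar\sigma_0^2=0$, $\bar\sigma_t^2=\alpha_t^2\bar\sigma_{t-1}^2+\sigma_t^2$, and assume $\bar\gamma_T=0$. *Forward process $q$.* $X_0\sim q_0$; $Y_0\mid X_0\sim \mathrm N(\mu_\varphi(X_0),\sigma_{\rm lat}^2\mathrm I_d)$ with $\sigma_{\rm lat}>0$ (density $\mathcal E_\varphi$); given $(X_0,Y_0)$ the two channels are independent Markov chains: each token independently stays equal to $m$ once masked and otherwise is kept with probability $\gamma_t$ and masked with probability $1-\gamma_t$; and $Y_t=\alpha_tY_{t-1}+\sigma_t\varepsilon_t$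 with i.i.d. $\varepsilon_t\sim\mathrm N(0,\mathrm I_d)$. Write $Z_t=(X_t,Y_t)$. *Generative process $p^\theta$.* Let $x_\theta(z,t)$ be a measurable family of $S$ probability vectors $x^i_\theta(z,t)$ on $\mathsf X$ with zero mask coordinate, and $y_\theta(z,t)\in\mathsf Y$ measurable in $z$. Put $$p^\theta(z_{0:T})=\mathbf 1[x_T=(m,\dots,m)]\,\mathrm N(y_T;0,\bar\sigma_T^2\mathrm I_d)\prod_{t=1}^T p^{\mathsf X}_{t-1|t}(x_{t-1}|z_t)\,p^{\mathsf Y}_{t-1|t}(y_{t-1}|z_t),$$ where $p^{\mathsf X}_{t-1|t}(\cdot|z_t)$ is the product over positions of the distributions equal to $x_t^i$ if $x_t^i\ne m$ and to $\frac{(1-\bar\gamma_{t-1})m+(\bar\gamma_{t-1}-\bar\gamma_t)x^i_\theta(z_t,t)}{1-\bar\gamma_t}$ if $x_t^i=m$; for $t\ge2$, $p^{\mathsf Y}_{t-1|t}(\cdot|z_t)$ is Gaussian with mean $\frac{\alpha_t\bar\sigma_{t-1}^2}{\bar\sigma_t^2}y_t+\frac{\bar\alpha_{t-1}\sigma_t^2}{\bar\sigma_t^2}y_\theta(z_t,t)$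 and covariance $\frac{\bar\sigma_{t-1}^2\sigma_t^2}{\bar\sigma_t^2}\mathrm I_d$; and $p^{\mathsf Y}_{0|1}(\cdot|z_1)=\mathrm N(y_\theta(z_1,1),\sigma_{\rm lat}^2\mathrm I_d)$. Let $p_0^\theta(x_0)$ be the marginal probability of $x_0$. **Statement.** All quantities below take values in $(-\infty,\infty]$, with $0\cdot\infty=0$, $0/0=0$ and $\log 0=-\infty$. Set $$\mathcal L=\mathrm L^{\mathsf X}_T+\mathrm L^{\mathsf Y}_T+\mathrm L^{\mathsf X}_0+\mathrm L^{\mathsf Z}_0+\sum_{t=2}^T\mathbb E\big[\lambda^{\mathsf X}_t\log\langle x_\theta(Z_t,t),X_0\rangle\big]+\mathbb E\big[\lambda^{\mathsf Y}_t\|Y_0-y_\theta(Z_t,t)\|^2\big],$$ $$\lambda^{\mathsf X}_t=\frac{\bar\gamma_t-\bar\gamma_{t-1}}{1-\bar\gamma_t},\qquad \lambda^{\mathsf Y}_t=\frac{\bar\alpha_{t-1}^2\sigma_t^2}{2\bar\sigma_{t-1}^2\bar\sigma_t^2},$$ where $\log\langle x_\theta(Z_t,t),X_0\rangle=\sum_{i=1}^S\log\langle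 x_\theta^i(Z_t,t),X_0^i\rangle$, $\mathrm L^{\mathsf X}_T=\mathbb E\,\mathrm{KL}(q_{T|0}(\cdot|X_0)\,|\,\delta_{(m,\dots,m)})$, $\mathrm L^{\mathsf Y}_T=\mathbb E\,\mathrm{KL}(q_{T|0}(\cdot|Y_0)\,|\,\mathrm N(0,\bar\sigma_T^2\mathrm I_d))$, $\mathrm L^{\mathsf X}_0=-\mathbb E\log p^{\mathsf X}_{0|1}(X_0|Z_1)$ and $\mathrm L^{\mathsf Z}_0=\mathbb E\|Y_0-y_\theta(Z_1,1)\|^2/(2\sigma_{\rm lat}^2)-d/2$; all expectations are under the forward process. Then $$\mathbb E[-\log p^\theta_0(X_0)]\ \le\ \mathbb E\Big[\log\frac{q(Z_{1:T}|Z_0)\,\mathcal E_\varphi(Y_0|X_0)}{p^\theta(Z_{0:T})}\Big]\ \le\ \mathcal L,$$ and the second inequality (the middle term being the variational negative ELBO) is an equality if $x_\theta$ carries over unmasked tokens, i.e. $x^i_\theta(z,t)=x^i$ for all $1\le t\le T$ and all $z=(x,y)$ and $i$ with $x^i\ne m$. In particular $\mathbb E[-\log p^\theta_0(X_0)]\le\mathcal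 L$. -/

import Mathlib

noncomputable section

namespace FujiLDDM

/-- Tokens: `V` ordinary tokens and one mask token, i.e. a vocabulary of size `K = V + 1`. -/
abbrev Tok (V : ℕ) : Type := Fin (V + 1)

/-- The mask token, the last element of the vocabulary. -/
def mask (V : ℕ) : Tok V := Fin.last V

/-- Token sequences of length `S` (the data channel). -/
abbrev TokSeq (S V : ℕ) : Type := Fin S → Tok V

/-- The latent space `ℝ^d` with its Euclidean norm. -/
abbrev Latent (d : ℕ) : Type := EuclideanSpace ℝ (Fin d)

/-- Joint states `z = (x, y)`. -/
abbrev State (S V d : ℕ) : Type := TokSeq S V × Latent d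

/-- Joint paths `z_{0:T} = (z_0, …, z_T)`. -/
abbrev Path (S V d T : ℕ) : Type := Fin (T + 1) → State S V d

/-- The one-hot vector of a token. -/
def oneHot {V : ℕ} (v : Tok V) : Tok V → ℝ := fun w => if w = v then 1 else 0

/-- The density `N(y; μ, v I_d)` at `y` of the Gaussian law with mean `μ` and covariance `v I_d`. -/
def gaussDensity {d : ℕ} (μ : Latent d) (v : ℝ) (y : Latent d) : ℝ :=
  (2 * Real.pi * v) ^ (-(d : ℝ) / 2) * Real.exp (-‖y - μ‖ ^ 2 / (2 * v))

/-- The Gaussian law with mean `μ` and covariance `v I_d`, for `v > 0`. -/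
def gaussLaw {d : ℕ} (μ : Latent d) (v : ℝ) : MeasureTheory.Measure (Latent d) :=
  MeasureTheory.volume.withDensity fun y => ENNReal.ofReal (gaussDensity μ v y)

/-- One masking step of a single token, with retention probability `g`:
the probability of moving from `x` to `x'`. -/
def tokForward {V : ℕ} (g : ℝ) (x x' : Tok V) : ℝ :=
  if x = mask V then oneHot (mask V) x' else g * oneHot x x' + (1 - g) * oneHot (mask V) x'

/-- The reverse (bridge) transition of a single token from the noisy token `x`, with clean token
distribution `p`; here `gs` and `gt` are the cumulative retention probabilities at times `t - 1`
and `t`. -/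
def tokBridge {V : ℕ} (gs gt : ℝ) (x : Tok V) (p : Tok V → ℝ) (x' : Tok V) : ℝ :=
  if x = mask V then ((1 - gs) * oneHot (mask V) x' + (gs - gt) * p x') / (1 - gt)
  else oneHot x x'

/-- The data of a FUJI latent discrete diffusion model with `S` tokens per sequence, `V` non-mask
tokens, latent dimension `d` and time horizon `T`. -/
structure Model (S V d T : ℕ) where
  /-- the data distribution -/
  data : PMF (TokSeq S V)
  /-- the mean of the Gaussian encoder -/
  encMean : TokSeq S V → Latent d
  /-- the fixed standard deviation of the encoder -/
  sigmaLat : ℝ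
  sigmaLat_pos : 0 < sigmaLat
  /-- the one-step masking schedule `γ_t` -/
  gam : ℕ → ℝ
  gam_mem : ∀ t, 1 ≤ t → t ≤ T → 0 ≤ gam t ∧ gam t ≤ 1
  /-- the chain is fully masked at time `T` -/
  gam_prod : ∏ s ∈ Finset.Icc 1 T, gam s = 0
  /-- the one-step latent schedule `α_t` -/
  alpha : ℕ → ℝ
  alpha_nonneg : ∀ t, 1 ≤ t → t ≤ T → 0 ≤ alpha t
  /-- the one-step latent schedule `σ_t` -/
  sigma : ℕ → ℝ
  sigma_pos : ∀ t, 1 ≤ t → t ≤ T → 0 < sigma t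
  /-- the discrete denoiser: at time `t` and state `z`, a categorical distribution per position -/
  xDen : ℕ → State S V d → Fin S → Tok V → ℝ
  xDen_measurable : ∀ t i v, Measurable fun z => xDen t z i v
  xDen_nonneg : ∀ t z i v, 0 ≤ xDen t z i v
  xDen_sum : ∀ t z i, ∑ v, xDen t z i v = 1
  xDen_mask : ∀ t z i, xDen t z i (mask V) = 0
  /-- the continuous denoiser -/
  yDen : ℕ → State S V d → Latent d
  yDen_measurable : ∀ t, Measurable (yDen t)

namespace Model

variable {S V d T : ℕ} (M : Model S V d T)

/-- `γ̄_t = γ_1 ⋯ γ_t`. -/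
def gamBar (t : ℕ) : ℝ := ∏ s ∈ Finset.Icc 1 t, M.gam s

/-- `ᾱ_t = α_1 ⋯ α_t`. -/
def alphaBar (t : ℕ) : ℝ := ∏ s ∈ Finset.Icc 1 t, M.alpha s

/-- `σ̄_t²`, defined by `σ̄_0² = 0` and `σ̄_t² = α_t² σ̄_{t-1}² + σ_t²`. -/
def sigmaBarSq : ℕ → ℝ
  | 0 => 0
  | t + 1 => M.alpha (t + 1) ^ 2 * sigmaBarSq t + M.sigma (t + 1) ^ 2

/-! ### Forward process -/

/-- One-step forward transition probability `q(x_t | x_{t-1})` of the tokens, from `x` to `x'`. -/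
def xForward (t : ℕ) (x x' : TokSeq S V) : ℝ := ∏ i, tokForward (M.gam t) (x i) (x' i)

/-- One-step forward transition density `q(y_t | y_{t-1})` of the latents, from `y` to `y'`. -/
def yForward (t : ℕ) (y y' : Latent d) : ℝ := gaussDensity (M.alpha t • y) (M.sigma t ^ 2) y'

/-- The encoder density at `y`, given the tokens `x`. -/
def encoder (x : TokSeq S V) (y : Latent d) : ℝ := gaussDensity (M.encMean x) (M.sigmaLat ^ 2) y

/-- The conditional law `q_{t|0}(· | x)` of the tokens at time `t` given the tokens `x` at time `0`,
by iterating the one-step transitions. -/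
def xMarginal : ℕ → TokSeq S V → MeasureTheory.Measure (TokSeq S V)
  | 0, x => MeasureTheory.Measure.dirac x
  | t + 1, x => (xMarginal t x).bind fun x' =>
      MeasureTheory.Measure.count.withDensity fun x'' => ENNReal.ofReal (M.xForward (t + 1) x' x'')

/-- The conditional law `q_{t|0}(· | y)` of the latent at time `t` given the latent `y` at time `0`,
by iterating the one-step transitions. -/
def yMarginal : ℕ → Latent d → MeasureTheory.Measure (Latent d)
  | 0, y => MeasureTheory.Measure.dirac y
  | t + 1, y => (yMarginal t y).bind fun y' => gaussLaw (M.alpha (t + 1) • y') (M.sigma (t + 1) ^ 2)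

/-- The reference measure on paths: at every time, counting measure on tokens times Lebesgue
measure on latents. -/
def pathRef (S V d T : ℕ) : MeasureTheory.Measure (Path S V d T) :=
  MeasureTheory.Measure.pi fun _ => MeasureTheory.Measure.count.prod MeasureTheory.volume

/-- The law of the forward path `(Z_0, …, Z_T)` given `X_0 = x₀`, with density
`1[X_0 = x₀] E(y_0 | x₀) ∏_t q(x_t | x_{t-1}) q(y_t | y_{t-1})`. -/
def condForwardLaw (x₀ : TokSeq S V) : MeasureTheory.Measure (Path S V d T) :=
  (pathRef S V d T).withDensity fun z => ENNReal.ofReal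
    ((if (z 0).1 = x₀ then 1 else 0) * M.encoder (z 0).1 (z 0).2 *
      ∏ k : Fin T, (M.xForward (k + 1) (z k.castSucc).1 (z k.succ).1 *
        M.yForward (k + 1) (z k.castSucc).2 (z k.succ).2))

/-- The law of the forward path, started from the data distribution. -/
def forwardLaw : MeasureTheory.Measure (Path S V d T) :=
  ∑ x₀, M.data x₀ • M.condForwardLaw x₀

/-! ### Generative process -/

/-- The reverse transition probability of the tokens from the joint state `z` at time `t` to `x'`
at time `t - 1`. -/
def xReverse (t : ℕ) (z : State S V d) (x' : TokSeq S V) : ℝ :=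
  ∏ i, tokBridge (M.gamBar (t - 1)) (M.gamBar t) (z.1 i) (M.xDen t z i) (x' i)

/-- The mean of the Gaussian bridge at time `t - 1` given `y_t` and `y_0`. -/
def bridgeMean (t : ℕ) (yt y0 : Latent d) : Latent d :=
  (M.alpha t * M.sigmaBarSq (t - 1) / M.sigmaBarSq t) • yt +
    (M.alphaBar (t - 1) * M.sigma t ^ 2 / M.sigmaBarSq t) • y0

/-- The variance of the Gaussian bridge at time `t - 1`. -/
def bridgeVar (t : ℕ) : ℝ := M.sigmaBarSq (t - 1) * M.sigma t ^ 2 / M.sigmaBarSq t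

/-- The reverse transition density of the latents from the joint state `z` at time `t` to `y'` at
time `t - 1`: the Gaussian bridge with the clean latent replaced by its prediction if `t ≥ 2`, and
the Gaussian with mean the prediction and variance `σ_lat²` in the last step `t = 1` (where the
bridge would be a Dirac mass). -/
def yReverse (t : ℕ) (z : State S V d) (y' : Latent d) : ℝ :=
  if t = 1 then gaussDensity (M.yDen 1 z) (M.sigmaLat ^ 2) y'
  else gaussDensity (M.bridgeMean t z.2 (M.yDen t z)) (M.bridgeVar t) y'

/-- The law of the generative path, started from all-mask tokens and `N(0, σ̄_T² I_d)`, with density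
`p(x_T) p(y_T) ∏_t p(x_{t-1} | z_t) p(y_{t-1} | z_t)`. -/
def modelLaw : MeasureTheory.Measure (Path S V d T) :=
  (pathRef S V d T).withDensity fun z => ENNReal.ofReal
    ((if (z (Fin.last T)).1 = (fun _ => mask V) then 1 else 0) *
      gaussDensity 0 (M.sigmaBarSq T) (z (Fin.last T)).2 *
      ∏ k : Fin T, (M.xReverse (k + 1) (z k.succ) (z k.castSucc).1 *
        M.yReverse (k + 1) (z k.succ) (z k.castSucc).2))

/-! ### Likelihood, negative ELBO, and the explicit objective -/

/-- The probability that the generated token sequence at time `0` is `x`. -/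
def modelProb (x : TokSeq S V) : ENNReal := M.modelLaw {z | (z 0).1 = x}

/-- The expected negative log-likelihood `E[-log p_0(X_0)]`, in `[0, ∞]`. -/
def negLogLik : EReal := ∑ x, (M.data x : EReal) * -ENNReal.log (M.modelProb x)

/-- The variational negative ELBO
`E[log (q(Z_{1:T}, Y_0 | X_0) / p(Z_{0:T}))]`, written as an averaged Kullback-Leibler divergence
of the forward path law given `X_0` with respect to the generative path law. -/
def negELBO : ENNReal :=
  ∑ x₀, M.data x₀ * InformationTheory.klDiv (M.condForwardLaw x₀) M.modelLaw

/-- The state at time `t ≤ T` of a path. -/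
def at_ (z : Path S V d T) (t : ℕ) : State S V d := z (Fin.ofNat (T + 1) t)

/-- The weight of the cross-entropy term at time `t`; it is nonpositive. -/
def weightX (t : ℕ) : ℝ := (M.gamBar t - M.gamBar (t - 1)) / (1 - M.gamBar t)

/-- The weight of the squared-error term at time `t`. -/
def weightY (t : ℕ) : ℝ :=
  M.alphaBar (t - 1) ^ 2 * M.sigma t ^ 2 / (2 * M.sigmaBarSq (t - 1) * M.sigmaBarSq t)

/-- `⟨x_θ(z, t), x⟩`: the probability that the product of the predicted categorical distributions
gives to the sequence `x`. Its logarithm is the sum over positions of `log ⟨x_θ^i(z, t), x^i⟩`. -/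
def predProb (t : ℕ) (z : State S V d) (x : TokSeq S V) : ℝ := ∏ i, M.xDen t z i (x i)

/-- `L^X_T = E[KL(q_{T|0}(· | X_0) | p_T)]`, with `p_T` the Dirac mass at the all-mask sequence. -/
def lossXT : ENNReal :=
  ∫⁻ z, InformationTheory.klDiv (M.xMarginal T (at_ z 0).1)
    (MeasureTheory.Measure.dirac fun _ => mask V) ∂M.forwardLaw

/-- `L^Y_T = E[KL(q_{T|0}(· | Y_0) | N(0, σ̄_T² I_d))]`. -/
def lossYT : ENNReal :=
  ∫⁻ z, InformationTheory.klDiv (M.yMarginal T (at_ z 0).2) (gaussLaw 0 (M.sigmaBarSq T))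
    ∂M.forwardLaw

/-- `L^X_0 = -E[log p_{0|1}(X_0 | Z_1)]`, the expectation of a `[0, ∞]`-valued variable. -/
def lossX0 : ENNReal :=
  ∫⁻ z, (-ENNReal.log (ENNReal.ofReal (M.xReverse 1 (at_ z 1) (at_ z 0).1))).toENNReal
    ∂M.forwardLaw

/-- `L^Z_0 = E‖Y_0 - y_θ(Z_1)‖² / (2 σ_lat²) - d / 2`. -/
def lossZ0 : EReal :=
  ((∫⁻ z, ENNReal.ofReal (‖(at_ z 0).2 - M.yDen 1 (at_ z 1)‖ ^ 2 / (2 * M.sigmaLat ^ 2))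
    ∂M.forwardLaw : ENNReal) : EReal) - (((d : ℝ) / 2 : ℝ) : EReal)

/-- `E[λ^X_t log ⟨x_θ(Z_t, t), X_0⟩]`. Both factors are nonpositive, so this is the expectation of a
`[0, ∞]`-valued variable (with `0 · ∞ = 0`). -/
def lossX (t : ℕ) : ENNReal :=
  ∫⁻ z, ((M.weightX t : EReal) *
    ENNReal.log (ENNReal.ofReal (M.predProb t (at_ z t) (at_ z 0).1))).toENNReal ∂M.forwardLaw

/-- `E[λ^Y_t ‖Y_0 - y_θ(Z_t, t)‖²]`. -/
def lossY (t : ℕ) : ENNReal :=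
  ∫⁻ z, ENNReal.ofReal (M.weightY t * ‖(at_ z 0).2 - M.yDen t (at_ z t)‖ ^ 2) ∂M.forwardLaw

/-- The explicit objective, with values in `(-∞, ∞]`. -/
def loss : EReal :=
  (M.lossXT : EReal) + (M.lossYT : EReal) + (M.lossX0 : EReal) + M.lossZ0 +
    ∑ t ∈ Finset.Icc 2 T, ((M.lossX t : EReal) + (M.lossY t : EReal))

/-- The discrete denoiser copies the tokens that are already unmasked. -/
def CarryOver : Prop :=
  ∀ t, 1 ≤ t → t ≤ T → ∀ z i, z.1 i ≠ mask V → M.xDen t z i = oneHot (z.1 i)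

end Model

end FujiLDDM

end

/-! Fix a data point `x₀` without mask tokens. By Bayes' rule, step by step, the forward density
given X_0 = x₀ is rewritten backwards: encoder density of Y_0, law of Z_T given Z_0, and the bridges
of Z_k given Z_{k+1} and Z_0 for 1 ≤ k < T (`prod_forward_eq`). Each Gaussian factor then faces a
Gaussian factor of the generative density with the same covariance: the encoder faces the last
reverse step, the law of Y_T the prior, each bridge a reverse step. Normalizing constants cancel, so
on the support of the forward density f the model density is f · exp N · Φ (`modelDensity_eq_mul`).
Here N ≥ 0 collects the squared distances to the forward means, and 0 ≤ Φ ≤ 1 collects those to the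
model means together with the probabilities of unmasking the right tokens.

Hence KL + E[N] = E[-log Φ] in [0, ∞] (`klDiv_withDensity_add`), and no difference of infinite
quantities occurs. E[N] consists of T + 1 Gaussian terms d/2. In E[-log Φ], bias-variance turns the
prior and each bridge into d/2 plus a squared difference of means, that is, into L^Y_T and the λ^Y
terms (`lintegral_last_sq`, `lintegral_bridgeDist`). Only T of these d/2 appear, which leaves the
-d/2 of L^Z_0 (`klDiv_add_dim`). L^X_T vanishes because γ̄_T = 0.

For the tokens, the bridge unmasks a masked position with probability -λ^X, so the exact term is
-λ^X times the sum of -log ⟨x_θ^i, x₀^i⟩ over the masked positions. The objective sums over all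
positions; the extra terms are nonnegative, and they vanish if unmasked tokens are carried over,
since an unmasked token equals the clean one (`lintegral_unmaskProb_le`, `lintegral_unmaskProb_eq`).

If `x₀` contains a mask, the generative process cannot produce it, and both the divergence and L^X_0
are infinite.

The bound on the likelihood is data processing: under the indicator of X_0 = x₀ the forward law
becomes a Dirac mass, and its divergence is -log p_0(x₀) (`neg_log_measure_le_klDiv`). -/

noncomputable section

namespace FujiLDDM

open MeasureTheory ENNReal Real Set

/-! ### Isotropic Gaussian densities -/

section Gaussian

variable {d : ℕ}

lemma gaussDensity_pos (μ : Latent d) {v : ℝ} (hv : 0 < v) (y : Latent d) :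
    0 < gaussDensity μ v y := by
  unfold gaussDensity; positivity

lemma gaussDensity_nonneg (μ : Latent d) {v : ℝ} (hv : 0 < v) (y : Latent d) :
    0 ≤ gaussDensity μ v y := (gaussDensity_pos μ hv y).le

@[fun_prop]
lemma measurable_gaussDensity {α : Type*} [MeasurableSpace α] {m y : α → Latent d}
    (hm : Measurable m) (hy : Measurable y) (v : ℝ) :
    Measurable fun a => gaussDensity (m a) v (y a) := by
  unfold gaussDensity; fun_prop

lemma gaussDensity_sub (μ : Latent d) (v : ℝ) (y : Latent d) :
    gaussDensity μ v y = gaussDensity 0 v (y - μ) := by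
  simp [gaussDensity]

/-- Two Gaussian densities with the same covariance differ by an exponential factor. -/
lemma gaussDensity_eq_mul_exp (μ μ' : Latent d) (v : ℝ) (y : Latent d) :
    gaussDensity μ' v y = gaussDensity μ v y * Real.exp (‖y - μ‖ ^ 2 / (2 * v)) *
      Real.exp (-(‖y - μ'‖ ^ 2 / (2 * v))) := by
  unfold gaussDensity
  have : Real.exp (-‖y - μ‖ ^ 2 / (2 * v)) * Real.exp (‖y - μ‖ ^ 2 / (2 * v)) = 1 := by
    rw [← Real.exp_add]; ring_nf; simp
  rw [mul_assoc (_ ^ _), this, neg_div]; ring_nf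

lemma integrable_norm_pow_mul_exp (hd : d ≠ 0) {b : ℝ} (hb : 0 < b) (k : ℕ) :
    Integrable fun y : Latent d => ‖y‖ ^ k * Real.exp (-b * ‖y‖ ^ 2) := by
  have : Nontrivial (Latent d) := by
    have : Nonempty (Fin d) := ⟨⟨0, Nat.pos_of_ne_zero hd⟩⟩
    infer_instance
  rw [integrable_fun_norm_addHaar volume (f := fun r : ℝ => r ^ k * Real.exp (-b * r ^ 2))]
  refine (integrableOn_rpow_mul_exp_neg_mul_sq hb
    (s := ((d - 1 + k : ℕ) : ℝ)) (by linarith [Nat.cast_nonneg (α := ℝ) (d - 1 + k)])).congr_fun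
    (fun x hx => ?_) measurableSet_Ioi
  simp only [Real.rpow_natCast, smul_eq_mul, finrank_euclideanSpace, Fintype.card_fin, pow_add,
    mul_assoc]

lemma integral_exp_neg_sq {b : ℝ} (hb : 0 < b) :
    ∫ y : Latent d, Real.exp (-b * ‖y‖ ^ 2) = (Real.pi / b) ^ ((d : ℝ) / 2) := by
  rw [GaussianFourier.integral_rexp_neg_mul_sq_norm hb]; simp

/-- In polar coordinates both this integral and the unweighted one are the same sphere constant
times a Gamma integral, so their ratio d / (2b) comes from Γ(d/2 + 1) = (d/2) Γ(d/2). -/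
lemma integral_sq_mul_exp_neg_sq {b : ℝ} (hb : 0 < b) :
    ∫ y : Latent d, ‖y‖ ^ 2 * Real.exp (-b * ‖y‖ ^ 2) =
      d / (2 * b) * (Real.pi / b) ^ ((d : ℝ) / 2) := by
  rcases Nat.eq_zero_or_pos d with rfl | hd
  · have : ∀ y : Latent 0, ‖y‖ = 0 := fun y => by rw [Subsingleton.elim y 0, norm_zero]
    simp [this]
  have : Nontrivial (Latent d) := by
    have : Nonempty (Fin d) := ⟨⟨0, hd⟩⟩
    infer_instance
  rw [← integral_exp_neg_sq hb]
  rw [integral_fun_norm_addHaar volume (fun r : ℝ => r ^ 2 * Real.exp (-b * r ^ 2)),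
    integral_fun_norm_addHaar volume (fun r : ℝ => Real.exp (-b * r ^ 2))]
  have h1 : ∀ k : ℕ, ∫ y in Ioi (0 : ℝ), y ^ (d - 1) * (y ^ k * Real.exp (-b * y ^ 2)) =
      b ^ (-((d + k : ℝ)) / 2) * (1 / 2) * Real.Gamma ((d + k : ℝ) / 2) := by
    intro k
    have := integral_rpow_mul_exp_neg_mul_rpow (p := 2) (q := ((d - 1 + k : ℕ) : ℝ)) (b := b)
      (by norm_num) (by linarith [Nat.cast_nonneg (α := ℝ) (d - 1 + k)]) hb
    have e : (((d - 1 + k : ℕ) : ℝ) + 1) = d + k := by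
      rw [Nat.cast_add, Nat.cast_sub hd]; push_cast; ring
    rw [e] at this
    rw [← this]
    refine setIntegral_congr_fun measurableSet_Ioi fun x hx => ?_
    simp only [Real.rpow_natCast, Real.rpow_two, pow_add, mul_assoc]
  have h2 := h1 2
  have h0 := h1 0
  simp only [pow_zero, one_mul] at h0
  simp only [finrank_euclideanSpace, Fintype.card_fin, smul_eq_mul]
  rw [h2, h0]
  have e2 : ((d : ℝ) + (2 : ℕ)) / 2 = d / 2 + 1 := by push_cast; ring
  have hd' : (0 : ℝ) < d := by exact_mod_cast hd
  have e3 : (-((d : ℝ) + (2 : ℕ))) / 2 = -(d + (0 : ℕ)) / 2 - 1 := by push_cast; ring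
  rw [e2, e3, Real.Gamma_add_one (by positivity), Real.rpow_sub hb, Real.rpow_one]
  simp only [Nat.cast_zero, add_zero, nsmul_eq_mul]
  field_simp

lemma gaussDensity_zero (v : ℝ) (y : Latent d) :
    gaussDensity 0 v y = (2 * Real.pi * v) ^ (-(d : ℝ) / 2) *
      Real.exp (-(1 / (2 * v)) * ‖y‖ ^ 2) := by
  simp only [gaussDensity, sub_zero]; congr 2; ring_nf

lemma gaussDensity_norm_const {v : ℝ} (hv : 0 < v) :
    (2 * Real.pi * v) ^ (-(d : ℝ) / 2) * (Real.pi / (1 / (2 * v))) ^ ((d : ℝ) / 2) = 1 := by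
  have : Real.pi / (1 / (2 * v)) = 2 * Real.pi * v := by field_simp
  rw [this, ← Real.rpow_add (by positivity)]
  ring_nf; simp

/-- Polar coordinates need d ≠ 0; in dimension 0 Lebesgue measure is a Dirac mass. -/
lemma integrable_sq_mul_exp {b : ℝ} (hb : 0 < b) (k : ℕ) :
    Integrable fun y : Latent d => ‖y‖ ^ k * Real.exp (-b * ‖y‖ ^ 2) := by
  rcases eq_or_ne d 0 with rfl | hd
  · have : (volume : Measure (Latent 0)) = Measure.dirac 0 :=
      volume_euclideanSpace_eq_dirac _
    rw [this]
    exact integrable_dirac (by simp)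
  · exact integrable_norm_pow_mul_exp hd hb k

/-- Gaussian densities are normalized. -/
lemma lintegral_gaussDensity (μ : Latent d) {v : ℝ} (hv : 0 < v) :
    ∫⁻ y, ENNReal.ofReal (gaussDensity μ v y) = 1 := by
  rw [lintegral_congr fun y => congrArg ENNReal.ofReal (gaussDensity_sub μ v y),
    lintegral_sub_right_eq_self (fun y => ENNReal.ofReal (gaussDensity 0 v y))]
  have hb : 0 < 1 / (2 * v) := by positivity
  rw [← ofReal_integral_eq_lintegral_ofReal]
  · simp_rw [gaussDensity_zero, integral_const_mul, integral_exp_neg_sq hb,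
      gaussDensity_norm_const hv, ENNReal.ofReal_one]
  · refine ((integrable_sq_mul_exp hb 0).const_mul ((2 * Real.pi * v) ^ (-(d : ℝ) / 2))).congr
      (ae_of_all _ fun y => ?_)
    simp [gaussDensity_zero]
  · exact ae_of_all _ fun y => gaussDensity_nonneg _ hv _

lemma lintegral_gaussDensity_sq {v : ℝ} (hv : 0 < v) :
    ∫⁻ y : Latent d, ENNReal.ofReal (gaussDensity 0 v y) * ENNReal.ofReal (‖y‖ ^ 2 / (2 * v)) =
      ENNReal.ofReal (d / 2) := by
  have hb : 0 < 1 / (2 * v) := by positivity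
  have h : ∀ y : Latent d, ENNReal.ofReal (gaussDensity 0 v y) * ENNReal.ofReal (‖y‖ ^ 2 / (2 * v))
      = ENNReal.ofReal (((2 * Real.pi * v) ^ (-(d : ℝ) / 2) / (2 * v)) *
        (‖y‖ ^ 2 * Real.exp (-(1 / (2 * v)) * ‖y‖ ^ 2))) := fun y => by
    rw [← ENNReal.ofReal_mul (gaussDensity_nonneg _ hv _), gaussDensity_zero]
    ring_nf
  simp_rw [h]
  rw [← ofReal_integral_eq_lintegral_ofReal ((integrable_sq_mul_exp hb 2).const_mul _)
    (ae_of_all _ fun y => by positivity)]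
  rw [integral_const_mul, integral_sq_mul_exp_neg_sq hb]
  have := gaussDensity_norm_const (d := d) hv
  congr 1
  calc _ = ((2 * Real.pi * v) ^ (-(d : ℝ) / 2) * (Real.pi / (1 / (2 * v))) ^ ((d : ℝ) / 2)) *
        (1 / (2 * v) * (d / (2 * (1 / (2 * v))))) := by ring
    _ = _ := by rw [this]; field_simp

lemma gaussDensity_neg (v : ℝ) (y : Latent d) : gaussDensity 0 v (-y) = gaussDensity 0 v y := by
  simp [gaussDensity]

/-- The mean squared distance of a Gaussian vector to a fixed point. -/
lemma lintegral_gaussDensity_mul_sq (μ c : Latent d) {v : ℝ} (hv : 0 < v) :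
    ∫⁻ y, ENNReal.ofReal (gaussDensity μ v y) * ENNReal.ofReal (‖y - c‖ ^ 2 / (2 * v)) =
      ENNReal.ofReal (d / 2) + ENNReal.ofReal (‖μ - c‖ ^ 2 / (2 * v)) := by
  set a := μ - c
  set F : Latent d → ℝ≥0∞ := fun y =>
    ENNReal.ofReal (gaussDensity 0 v y) * ENNReal.ofReal (‖y + a‖ ^ 2 / (2 * v))
  have h1 : ∫⁻ y, ENNReal.ofReal (gaussDensity μ v y) * ENNReal.ofReal (‖y - c‖ ^ 2 / (2 * v)) =
      ∫⁻ y, F y := by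
    rw [← lintegral_sub_right_eq_self F μ]
    refine lintegral_congr fun y => ?_
    simp only [F, a, gaussDensity_sub μ]
    congr 5; abel
  -- Averaging F(y) with F(-y) removes the cross term through the parallelogram law, so everything
  -- stays in [0, ∞] and no signed integral is needed.
  have h2 : ∫⁻ y, F y = ∫⁻ y, F (-y) := (lintegral_neg_eq_self F).symm
  have hF : Measurable F := by fun_prop
  have h3 : ∀ y, F y + F (-y) =
      2 * (ENNReal.ofReal (gaussDensity 0 v y) * ENNReal.ofReal (‖y‖ ^ 2 / (2 * v)) +
        ENNReal.ofReal (gaussDensity 0 v y) * ENNReal.ofReal (‖a‖ ^ 2 / (2 * v))) := by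
    intro y
    simp only [F, gaussDensity_neg]
    have hn : ‖-y + a‖ = ‖y - a‖ := by rw [← norm_neg]; congr 1; abel
    rw [hn, ← mul_add, ← mul_add, ← ENNReal.ofReal_add (by positivity) (by positivity),
      ← ENNReal.ofReal_add (by positivity) (by positivity), mul_left_comm]
    congr 1
    have e2 : (2 : ℝ≥0∞) = ENNReal.ofReal 2 := by simp
    refine Eq.trans ?_ (congrArg (· * _) e2.symm)
    rw [← ENNReal.ofReal_mul (by norm_num), ← add_div, ← add_div]
    have := parallelogram_law_with_norm ℝ y a
    congr 1
    rw [show ‖y + a‖ ^ 2 + ‖y - a‖ ^ 2 = 2 * (‖y‖ ^ 2 + ‖a‖ ^ 2) by nlinarith]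
    ring
  have h4 : 2 * ∫⁻ y, F y = 2 * (ENNReal.ofReal (d / 2) + ENNReal.ofReal (‖a‖ ^ 2 / (2 * v))) := by
    calc 2 * ∫⁻ y, F y = ∫⁻ y, F y + F (-y) := by
          rw [lintegral_add_left hF, ← h2, two_mul]
      _ = _ := by
        simp_rw [h3]
        rw [lintegral_const_mul _ (by fun_prop), lintegral_add_left (by fun_prop),
          lintegral_gaussDensity_sq hv, lintegral_mul_const _ (by fun_prop),
          lintegral_gaussDensity _ hv, one_mul]
  rw [h1]
  exact (ENNReal.mul_right_inj (by simp) (by simp)).1 h4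

/-- Bayes' rule for Gaussian vectors: if `u ∼ N(m, s I)` and `w ∣ u ∼ N(a u, r I)`, then
`w ∼ N(a m, (a² s + r) I)` and `u ∣ w` is Gaussian. -/
lemma gaussDensity_bayes (m u w : Latent d) (a : ℝ) {s r : ℝ} (hs : 0 < s) (hr : 0 < r) :
    gaussDensity m s u * gaussDensity (a • u) r w =
      gaussDensity (a • m) (a ^ 2 * s + r) w *
        gaussDensity ((a * s / (a ^ 2 * s + r)) • w + (r / (a ^ 2 * s + r)) • m)
          (s * r / (a ^ 2 * s + r)) u := by
  have hv : 0 < a ^ 2 * s + r := by positivity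
  unfold gaussDensity
  have hc : (2 * Real.pi * s) ^ (-(d : ℝ) / 2) * (2 * Real.pi * r) ^ (-(d : ℝ) / 2) =
      (2 * Real.pi * (a ^ 2 * s + r)) ^ (-(d : ℝ) / 2) *
        (2 * Real.pi * (s * r / (a ^ 2 * s + r))) ^ (-(d : ℝ) / 2) := by
    rw [← Real.mul_rpow (by positivity) (by positivity),
      ← Real.mul_rpow (by positivity) (by positivity)]
    congr 1; field_simp
  -- Completing the square, one coordinate at a time.
  have he : -‖u - m‖ ^ 2 / (2 * s) + -‖w - a • u‖ ^ 2 / (2 * r) =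
      -‖w - a • m‖ ^ 2 / (2 * (a ^ 2 * s + r)) +
        -‖u - ((a * s / (a ^ 2 * s + r)) • w + (r / (a ^ 2 * s + r)) • m)‖ ^ 2 /
          (2 * (s * r / (a ^ 2 * s + r))) := by
    simp only [EuclideanSpace.norm_sq_eq, Real.norm_eq_abs, sq_abs, PiLp.sub_apply,
      PiLp.smul_apply, PiLp.add_apply, smul_eq_mul, ← Finset.sum_neg_distrib, Finset.sum_div,
      ← Finset.sum_add_distrib]
    refine Finset.sum_congr rfl fun i _ => ?_
    generalize u i = u, w i = w, m i = m
    field_simp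
    ring
  rw [mul_mul_mul_comm, ← Real.exp_add, mul_mul_mul_comm, ← Real.exp_add, hc, he]

end Gaussian

/-! ### Negative logarithms with values in `[0, ∞]` -/

section NegLog

/-- `-log x`, as an extended nonnegative number; equal to `∞` at `0`. -/
def negLog (x : ℝ) : ℝ≥0∞ := (-ENNReal.log (ENNReal.ofReal x)).toENNReal

lemma negLog_zero : negLog 0 = ∞ := by simp [negLog]

lemma negLog_one : negLog 1 = 0 := by simp [negLog]

lemma negLog_of_pos {x : ℝ} (hx : 0 < x) : negLog x = ENNReal.ofReal (-Real.log x) := by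
  rw [negLog, ENNReal.log_ofReal_of_pos hx, ← EReal.coe_neg, EReal.toENNReal_of_ne_top (by simp)]
  simp

lemma negLog_exp_neg (x : ℝ) : negLog (Real.exp (-x)) = ENNReal.ofReal x := by
  rw [negLog_of_pos (Real.exp_pos _), Real.log_exp, neg_neg]

/-- `negLog` truncates negative values to 0, so it is additive only on [0, 1]. All factors of the
model density are therefore arranged to lie there. -/
lemma negLog_mul {x y : ℝ} (hx : 0 ≤ x) (hx1 : x ≤ 1) (hy : 0 ≤ y) (hy1 : y ≤ 1) :
    negLog (x * y) = negLog x + negLog y := by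
  rcases hx.eq_or_lt with rfl | hx
  · simp [negLog_zero]
  rcases hy.eq_or_lt with rfl | hy
  · simp [negLog_zero]
  rw [negLog_of_pos hx, negLog_of_pos hy, negLog_of_pos (mul_pos hx hy),
    Real.log_mul hx.ne' hy.ne', neg_add, ENNReal.ofReal_add]
  · linarith [Real.log_nonpos hx.le hx1]
  · linarith [Real.log_nonpos hy.le hy1]

lemma negLog_prod {ι : Type*} (s : Finset ι) (φ : ι → ℝ) (h0 : ∀ i ∈ s, 0 ≤ φ i)
    (h1 : ∀ i ∈ s, φ i ≤ 1) : negLog (∏ i ∈ s, φ i) = ∑ i ∈ s, negLog (φ i) := by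
  classical
  induction s using Finset.induction_on with
  | empty => simp [negLog_one]
  | insert a s ha ih =>
    rw [Finset.prod_insert ha, Finset.sum_insert ha,
      negLog_mul (h0 _ (by simp)) (h1 _ (by simp))
        (Finset.prod_nonneg fun i hi => h0 i (by simp [hi]))
        (Finset.prod_le_one (fun i hi => h0 i (by simp [hi])) fun i hi => h1 i (by simp [hi])),
      ih (fun i hi => h0 i (by simp [hi])) fun i hi => h1 i (by simp [hi])]

lemma measurable_negLog : Measurable negLog := by
  unfold negLog; fun_prop

@[fun_prop]
lemma _root_.Measurable.negLog {α : Type*} [MeasurableSpace α] {φ : α → ℝ} (h : Measurable φ) :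
    Measurable fun a => FujiLDDM.negLog (φ a) := measurable_negLog.comp h

/-- Product of a nonpositive number with the logarithm of a number in `[0, 1]`. -/
lemma toENNReal_mul_log {w : ℝ} (hw : w ≤ 0) (x : ℝ) :
    ((w : EReal) * ENNReal.log (ENNReal.ofReal x)).toENNReal = ENNReal.ofReal (-w) * negLog x := by
  have h : (w : EReal) * ENNReal.log (ENNReal.ofReal x) =
      ((-w : ℝ) : EReal) * (-ENNReal.log (ENNReal.ofReal x)) := by
    rw [EReal.coe_neg, neg_mul_neg]
  rw [h, EReal.toENNReal_mul (by exact_mod_cast neg_nonneg.2 hw), negLog]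
  simp

end NegLog

/-! ### Kullback-Leibler divergence of measures with densities -/

section KL

open InformationTheory

variable {Ω : Type*} [MeasurableSpace Ω]

/-- Kullback-Leibler divergence of two probability densities `f`, `g` whose ratio is
`f / g = exp (-N) / Φ`: if `N` is nonnegative with finite expectation and `0 ≤ Φ ≤ 1`, then
`KL = E[-log Φ] - E[N]`. -/
lemma klDiv_withDensity_add (ref : Measure Ω) [SigmaFinite ref] {f g N Φ : Ω → ℝ}
    (hf : Measurable f) (hg : Measurable g) (hN : Measurable N) (hΦ : Measurable Φ)
    (hf0 : ∀ z, 0 ≤ f z) (hg0 : ∀ z, 0 ≤ g z) (hN0 : ∀ z, 0 ≤ N z)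
    (hΦ0 : ∀ z, 0 ≤ Φ z) (hΦ1 : ∀ z, f z ≠ 0 → Φ z ≤ 1)
    [IsProbabilityMeasure (ref.withDensity fun z => ENNReal.ofReal (f z))]
    [IsProbabilityMeasure (ref.withDensity fun z => ENNReal.ofReal (g z))]
    (hNfin : ∫⁻ z, ENNReal.ofReal (N z) ∂(ref.withDensity fun z => ENNReal.ofReal (f z)) ≠ ∞)
    (h : ∀ z, f z ≠ 0 → g z = f z * Real.exp (N z) * Φ z) :
    klDiv (ref.withDensity fun z => ENNReal.ofReal (f z))
        (ref.withDensity fun z => ENNReal.ofReal (g z)) +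
      ∫⁻ z, ENNReal.ofReal (N z) ∂(ref.withDensity fun z => ENNReal.ofReal (f z)) =
    ∫⁻ z, negLog (Φ z) ∂(ref.withDensity fun z => ENNReal.ofReal (f z)) := by
  set μ := ref.withDensity fun z => ENNReal.ofReal (f z) with hμ
  set ν := ref.withDensity fun z => ENNReal.ofReal (g z) with hν
  have hfne : ∀ᵐ z ∂μ, f z ≠ 0 := by
    rw [hμ, ae_withDensity_iff (by fun_prop)]
    refine ae_of_all _ fun z hz h0 => hz (by simp [h0])
  -- If Φ vanishes on a set of positive μ-measure, then g vanishes there too, so μ is not absolutely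
  -- continuous with respect to ν and both sides are ∞.
  by_cases hA : μ {z | Φ z = 0} = 0
  swap
  · have hs : MeasurableSet {z | Φ z = 0 ∧ f z ≠ 0} := by measurability
    have hac : ¬ μ ≪ ν := by
      intro hac
      have h1 : ν {z | Φ z = 0 ∧ f z ≠ 0} = 0 := by
        rw [hν, withDensity_apply _ hs, setLIntegral_eq_zero_iff hs (by fun_prop)]
        refine ae_of_all _ fun z hz => ?_
        simp [h z hz.2, hz.1]
      have h2 := hac h1
      refine hA ((measure_congr ?_).trans h2)
      filter_upwards [hfne] with z hz
      simp only [eq_iff_iff]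
      exact ⟨fun h => ⟨h, hz⟩, fun h => h.1⟩
    rw [klDiv_of_not_ac hac, top_add]
    symm
    by_contra hne
    refine hA ?_
    have := ae_lt_top (μ := μ) (f := fun z => negLog (Φ z)) (by fun_prop) hne
    rw [ae_iff] at this
    refine measure_mono_null (fun z hz => ?_) this
    simp only [mem_ofPred_eq] at hz ⊢
    simp [hz, negLog_zero]
  have hΦne : ∀ᵐ z ∂μ, Φ z ≠ 0 := by rw [ae_iff]; simpa using hA
  -- Off the null set where Φ = 0, g is positive wherever f is, so f / g is the density of μ with
  -- respect to ν.
  set r : Ω → ℝ≥0∞ := fun z => ENNReal.ofReal (f z / g z) with hr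
  have hrm : Measurable r := by fun_prop
  have hμr : μ = ν.withDensity r := by
    rw [hν, ← withDensity_mul _ (by fun_prop) hrm, hμ]
    refine withDensity_congr_ae ?_
    rw [hμ, ae_withDensity_iff (by fun_prop)] at hΦne
    filter_upwards [hΦne] with z hz
    simp only [Pi.mul_apply, hr]
    rw [← ENNReal.ofReal_mul (hg0 z)]
    by_cases hfz : f z = 0
    · simp [hfz]
    · have h1 : Φ z ≠ 0 := hz (by simpa using lt_of_le_of_ne (hf0 z) (Ne.symm hfz))
      have : g z ≠ 0 := by
        rw [h z hfz]; have := Real.exp_pos (N z); positivity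
      congr 1; field_simp
  have hac : μ ≪ ν := by rw [hμr]; exact withDensity_absolutelyContinuous _ _
  have hllr : llr μ ν =ᵐ[μ] fun z => -Real.log (Φ z) - N z := by
    have h1 : μ.rnDeriv ν =ᵐ[μ] r := by
      refine hac.ae_eq ?_
      rw [hμr]; exact Measure.rnDeriv_withDensity _ hrm
    filter_upwards [h1, hΦne, hfne] with z hz h2 h3
    rw [llr, hz, hr]
    have hfp : 0 < f z := lt_of_le_of_ne (hf0 z) (Ne.symm h3)
    have hΦp : 0 < Φ z := lt_of_le_of_ne (hΦ0 z) (Ne.symm h2)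
    rw [ENNReal.toReal_ofReal (div_nonneg hfp.le (hg0 z)), h z h3]
    have : f z / (f z * Real.exp (N z) * Φ z) = (Real.exp (N z))⁻¹ * (Φ z)⁻¹ := by
      field_simp
    rw [this, Real.log_mul (by positivity) (by positivity), Real.log_inv, Real.log_inv,
      Real.log_exp]
    ring
  have hNint : Integrable N μ := by
    refine ⟨by fun_prop, ?_⟩
    rw [hasFiniteIntegral_iff_ofReal (ae_of_all _ hN0)]
    exact lt_top_iff_ne_top.2 hNfin
  have hP0 : ∀ᵐ z ∂μ, 0 ≤ -Real.log (Φ z) := by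
    filter_upwards [hfne] with z h3
    linarith [Real.log_nonpos (hΦ0 z) (hΦ1 z h3)]
  have hPL : ∫⁻ z, negLog (Φ z) ∂μ = ∫⁻ z, ENNReal.ofReal (-Real.log (Φ z)) ∂μ := by
    refine lintegral_congr_ae ?_
    filter_upwards [hΦne] with z h2
    exact negLog_of_pos (lt_of_le_of_ne (hΦ0 z) (Ne.symm h2))
  rw [hPL]
  -- The log-likelihood ratio and -log Φ differ by the integrable N: either both are integrable and
  -- the integrals subtract, or both sides are ∞.
  by_cases hP : Integrable (fun z => -Real.log (Φ z)) μ
  · have hint : Integrable (llr μ ν) μ := (hP.sub hNint).congr hllr.symm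
    have hnn := integral_llr_add_sub_measure_univ_nonneg hac hint
    rw [klDiv_of_ac_of_integrable hac hint, ← ofReal_integral_eq_lintegral_ofReal hNint
      (ae_of_all _ hN0), ← ofReal_integral_eq_lintegral_ofReal hP hP0,
      ← ENNReal.ofReal_add hnn (integral_nonneg hN0), integral_congr_ae hllr,
      integral_sub hP hNint]
    simp
  · have hint : ¬ Integrable (llr μ ν) μ := by
      intro hint
      refine hP ((hint.add hNint).congr ?_)
      filter_upwards [hllr] with z hz
      simp [hz]
    rw [klDiv_of_not_integrable hint, top_add]
    symm
    by_contra hne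
    refine hP ⟨(hΦ.log.neg).aestronglyMeasurable, ?_⟩
    rw [hasFiniteIntegral_iff_ofReal hP0]
    exact lt_top_iff_ne_top.2 hne

/-- If `g` has full measure at `a` under `μ`, then `-log ν(g = a) ≤ KL(μ ∣ ν)`. -/
lemma neg_log_measure_le_klDiv {A : Type*} [MeasurableSpace A] [MeasurableSingletonClass A]
    (μ ν : Measure Ω) [IsProbabilityMeasure μ] [IsProbabilityMeasure ν] {g : Ω → A}
    (hg : Measurable g) (a : A) (h : ∀ᵐ z ∂μ, g z = a) :
    -ENNReal.log (ν {z | g z = a}) ≤ (klDiv μ ν : EReal) := by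
  classical
  set s := {z | g z = a} with hs
  have hsm : MeasurableSet s := hg (measurableSet_singleton a)
  by_cases hac : μ ≪ ν
  swap; · simp [hac]
  have hμs : μ s = 1 :=
    (mem_ae_iff_prob_eq_one hsm).1 h
  have hν0 : ν s ≠ 0 := fun h0 => by simp [hac h0] at hμs
  have hνr : 0 < ν.real s := ENNReal.toReal_pos hν0 (by simp)
  have hνr1 : ν.real s ≤ 1 := measureReal_le_one
  -- Pushing forward along this indicator can only decrease the divergence, and it turns μ into the
  -- Dirac mass at `true`.
  set c : Ω → Bool := fun z => decide (g z = a)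
  have hcm : Measurable c := by
    refine measurable_to_bool ?_
    convert! hsm using 1
    ext z; simp [c, hs]
  have hle := klDiv_map_le μ ν hcm
  have hμc : (μ.map c) = Measure.dirac true := by
    have : c =ᵐ[μ] fun _ => true := by filter_upwards [h] with z hz; simp [c, hz]
    rw [Measure.map_congr this]; simp
  have : IsProbabilityMeasure (ν.map c) := Measure.isProbabilityMeasure_map hcm.aemeasurable
  have hνc : (ν.map c).real {true} = ν.real s := by
    rw [map_measureReal_apply hcm (by simp)]
    congr 1; ext z; simp [c, hs]
  have hac' : μ.map c ≪ ν.map c := hac.map hcm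
  have hkey : ENNReal.ofReal (-Real.log (ν.real s)) ≤ klDiv μ ν := by
    refine le_trans ?_ hle
    by_cases hint : Integrable (llr (μ.map c) (ν.map c)) (μ.map c)
    swap; · rw [klDiv_of_not_integrable hint]; exact le_top
    rw [klDiv_of_ac_of_integrable hac' hint]
    refine ENNReal.ofReal_le_ofReal ?_
    rw [hμc, integral_dirac]
    simp only [llr_def]
    -- The density of this Dirac mass at `true`, times the mass ν s of `true`, must be 1; hence the
    -- log-ratio there is -log ν s.
    have hrn : ((Measure.dirac true).rnDeriv (ν.map c) true).toReal * ν.real s = 1 := by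
      have h1 := Measure.setLIntegral_rnDeriv (hμc ▸ hac') {true}
      rw [lintegral_singleton] at h1
      have h2 := congrArg ENNReal.toReal h1
      rw [ENNReal.toReal_mul, ← measureReal_def, hνc] at h2
      simpa using h2
    rw [eq_inv_of_mul_eq_one_left hrn, Real.log_inv, probReal_univ, probReal_univ]
    simp
  have : ENNReal.log (ν s) = Real.log (ν.real s) := by
    rw [ENNReal.log_pos_real hν0 (by simp)]; rfl
  rw [this, ← EReal.coe_neg]
  refine le_trans ?_ (EReal.coe_ennreal_le_coe_ennreal_iff.2 hkey)
  rw [EReal.coe_ennreal_ofReal]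
  exact_mod_cast le_max_left _ _

end KL

/-! ### Integration over Markov paths -/

section MarkovPath

variable {E : Type*}

/-- The product of the factors `F k (z k) (z (k + 1))` along a path. -/
def pathProd (F : ℕ → E → E → ℝ≥0∞) (n : ℕ) (z : Fin (n + 1) → E) : ℝ≥0∞ :=
  ∏ k : Fin n, F k (z k.castSucc) (z k.succ)

lemma pathProd_snoc (F : ℕ → E → E → ℝ≥0∞) (n : ℕ) (z : Fin (n + 1) → E) (v : E) :
    pathProd F (n + 1) (Fin.snoc z v : Fin (n + 2) → E) =
      pathProd F n z * F n (z (Fin.last n)) v := by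
  rw [pathProd, Fin.prod_univ_castSucc]
  congr 1
  · refine Finset.prod_congr rfl fun k _ => ?_
    rw [Fin.snoc_castSucc, ← Fin.castSucc_succ, Fin.snoc_castSucc]
    rfl
  · rw [Fin.snoc_castSucc, Fin.succ_last, Fin.snoc_last]
    rfl

lemma snoc_zero' {n : ℕ} (z : Fin (n + 1) → E) (v : E) :
    (Fin.snoc z v : Fin (n + 2) → E) 0 = z 0 := by
  rw [← Fin.castSucc_zero, Fin.snoc_castSucc]

variable [MeasurableSpace E] (ν : Measure E)

variable {F : ℕ → E → E → ℝ≥0∞} {a : E → ℝ≥0∞}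


lemma lintegral_path_zero {h : E → ℝ≥0∞} :
    ∫⁻ z : Fin 1 → E, a (z 0) * pathProd F 0 z * h (z 0) ∂(Measure.pi fun _ => ν) =
      ∫⁻ u, a u * h u ∂ν := by
  have := (measurePreserving_funUnique ν (Fin 1)).lintegral_comp_emb
    (MeasurableEquiv.measurableEmbedding _) (fun u => a u * h u)
  rw [← this]
  refine lintegral_congr fun z => ?_
  simp [pathProd, MeasurableEquiv.funUnique]

variable [SigmaFinite ν]

lemma lintegral_pi_snoc {n : ℕ} {G : (Fin (n + 2) → E) → ℝ≥0∞} (hG : Measurable G) :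
    ∫⁻ z, G z ∂(Measure.pi fun _ => ν) =
      ∫⁻ z : Fin (n + 1) → E, ∫⁻ v, G (Fin.snoc z v) ∂ν ∂(Measure.pi fun _ => ν) := by
  have h := (measurePreserving_piFinSuccAbove (fun _ : Fin (n + 2) => ν) (Fin.last _)).symm
  rw [← h.lintegral_comp_emb (MeasurableEquiv.measurableEmbedding _) G]
  rw [lintegral_prod_symm _ (by fun_prop)]
  refine lintegral_congr fun z => lintegral_congr fun v => ?_
  congr 1
  simp [MeasurableEquiv.piFinSuccAbove, Fin.insertNthEquiv]

lemma measurable_pathProd (hF : ∀ k, Measurable fun p : E × E => F k p.1 p.2) (n : ℕ) :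
    Measurable (pathProd F n) := by
  unfold pathProd
  refine Finset.measurable_prod _ fun k _ => ?_
  have : Measurable fun z : Fin (n + 1) → E => (z k.castSucc, z k.succ) := by fun_prop
  exact (hF k).comp this

lemma lintegral_path_succ (ha : Measurable a) (hF : ∀ k, Measurable fun p : E × E => F k p.1 p.2)
    {n : ℕ} {H : (Fin (n + 2) → E) → ℝ≥0∞} (hH : Measurable H) :
    ∫⁻ z, a (z 0) * pathProd F (n + 1) z * H z ∂(Measure.pi fun _ => ν) =
      ∫⁻ z : Fin (n + 1) → E, a (z 0) * pathProd F n z *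
        ∫⁻ v, F n (z (Fin.last n)) v * H (Fin.snoc z v) ∂ν ∂(Measure.pi fun _ => ν) := by
  have hp := measurable_pathProd hF (n + 1)
  rw [lintegral_pi_snoc ν (by fun_prop)]
  refine lintegral_congr fun z => ?_
  have hs : Measurable fun v : E => (Fin.snoc z v : Fin (n + 2) → E) := by
    refine measurable_pi_lambda _ fun i => ?_
    induction i using Fin.lastCases with
    | last => simpa using measurable_id'
    | cast i => simp
  have hFn : Measurable fun v => F n (z (Fin.last n)) v :=
    (hF n).comp (measurable_const.prodMk measurable_id)
  rw [← lintegral_const_mul _ (by fun_prop)]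
  refine lintegral_congr fun v => ?_
  rw [pathProd_snoc F, snoc_zero']
  ring

/-- The states after time n are integrated out one at a time, latest first, each against a
normalized transition. -/
lemma lintegral_path_restrict (ha : Measurable a)
    (hF : ∀ k, Measurable fun p : E × E => F k p.1 p.2) {n T : ℕ} (hnT : n ≤ T)
    (hF1 : ∀ k, n ≤ k → k < T → ∀ u, ∫⁻ v, F k u v ∂ν = 1)
    {H : (Fin (n + 1) → E) → ℝ≥0∞} (hH : Measurable H) :
    ∫⁻ z : Fin (T + 1) → E, a (z 0) * pathProd F T z *
        H (fun j => z (Fin.castLE (by omega) j)) ∂(Measure.pi fun _ => ν) =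
      ∫⁻ z : Fin (n + 1) → E, a (z 0) * pathProd F n z * H z ∂(Measure.pi fun _ => ν) := by
  induction T, hnT using Nat.le_induction with
  | base => rfl
  | succ T hnT ih =>
    rw [← ih fun k hk hk' => hF1 k hk (by omega), lintegral_path_succ ν ha hF (by fun_prop)]
    refine lintegral_congr fun z => ?_
    congr 1
    have : ∀ v, (fun j : Fin (n + 1) =>
        (Fin.snoc z v : Fin (T + 2) → E) (Fin.castLE (by omega) j)) =
        fun j => z (Fin.castLE (by omega) j) := by
      intro v; ext1 j
      have : (Fin.castLE (by omega) j : Fin (T + 2)) =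
          (Fin.castLE (by omega) j : Fin (T + 1)).castSucc := rfl
      rw [this, Fin.snoc_castSucc]
    simp_rw [this]
    have hFn : Measurable fun v => F T (z (Fin.last T)) v :=
      (hF T).comp (measurable_const.prodMk measurable_id)
    rw [lintegral_mul_const _ hFn, hF1 T hnT (by omega), one_mul]

/-- Data describing the multi-step transitions `Q k` of a Markov chain with one-step transitions
`F k`, started from the density `a`, and its backward transitions `B k` given the initial state. -/
structure IsBridge (a : E → ℝ≥0∞) (F Q : ℕ → E → E → ℝ≥0∞) (B : ℕ → E → E → E → ℝ≥0∞)
    (T : ℕ) : Prop where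
  meas_init : Measurable a
  meas_step : ∀ k, Measurable fun p : E × E => F k p.1 p.2
  meas_multi : ∀ k, Measurable fun p : E × E => Q k p.1 p.2
  meas_bridge : ∀ k, Measurable fun p : E × E × E => B k p.1 p.2.1 p.2.2
  step_one : ∀ k < T, ∀ u, ∫⁻ v, F k u v ∂ν = 1
  -- From here on conditions are asked only for initial states charged by `a`, since
  -- `tokForward_bayes` needs ordinary initial tokens. `bridge_one` also asks that `w` be reachable,
  -- because the token bridge degenerates to 0/0 at a masked token when γ̄ = 1.
  multi_one : ∀ z₀, a z₀ ≠ 0 → ∀ u, Q 1 z₀ u = F 0 z₀ u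
  bayes : ∀ k, 1 ≤ k → k < T → ∀ z₀, a z₀ ≠ 0 → ∀ u w,
    Q k z₀ u * F k u w = Q (k + 1) z₀ w * B k z₀ w u
  bridge_one : ∀ k, 1 ≤ k → k < T → ∀ z₀, a z₀ ≠ 0 → ∀ w, Q (k + 1) z₀ w ≠ 0 →
    ∫⁻ u, B k z₀ w u ∂ν = 1

variable {ν} {Q : ℕ → E → E → ℝ≥0∞} {B : ℕ → E → E → E → ℝ≥0∞} {T : ℕ}

/-- Tonelli followed by Bayes' rule: integrating forwards over (u, w) is the same as drawing w from
the multi-step law and then u from the bridge. -/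
lemma IsBridge.lintegral_swap (hb : IsBridge ν a F Q B T) {n : ℕ} (h1 : 1 ≤ n) (hn : n < T)
    {h : E → E → E → ℝ≥0∞} (hh : Measurable fun p : E × E × E => h p.1 p.2.1 p.2.2) :
    ∫⁻ z₀, a z₀ * ∫⁻ u, Q n z₀ u * ∫⁻ w, F n u w * h z₀ u w ∂ν ∂ν ∂ν =
      ∫⁻ z₀, a z₀ * ∫⁻ w, Q (n + 1) z₀ w * ∫⁻ u, B n z₀ w u * h z₀ u w ∂ν ∂ν ∂ν := by
  refine lintegral_congr fun z₀ => ?_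
  by_cases h0 : a z₀ = 0
  · simp [h0]
  congr 1
  have hQ : ∀ k, Measurable fun u => Q k z₀ u := fun k =>
    (hb.meas_multi k).comp (measurable_const.prodMk measurable_id)
  have hF := hb.meas_step n
  have hF' : ∀ u, Measurable fun w => F n u w := fun u =>
    hF.comp (measurable_const.prodMk measurable_id)
  have hh' : Measurable fun p : E × E => h z₀ p.1 p.2 :=
    hh.comp (measurable_const.prodMk (measurable_fst.prodMk measurable_snd))
  have hB : ∀ w, Measurable fun u => B n z₀ w u := fun w =>
    (hb.meas_bridge n).comp (measurable_const.prodMk (measurable_const.prodMk measurable_id))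
  calc ∫⁻ u, Q n z₀ u * ∫⁻ w, F n u w * h z₀ u w ∂ν ∂ν
      = ∫⁻ u, ∫⁻ w, Q n z₀ u * (F n u w * h z₀ u w) ∂ν ∂ν := by
        refine lintegral_congr fun u => (lintegral_const_mul _ ?_).symm
        exact (hF' u).mul (hh'.comp (measurable_const.prodMk measurable_id))
    _ = ∫⁻ w, ∫⁻ u, Q n z₀ u * (F n u w * h z₀ u w) ∂ν ∂ν := by
        refine lintegral_lintegral_swap (Measurable.aemeasurable ?_)
        exact ((hQ n).comp measurable_fst).mul (hF.mul hh')
    _ = _ := by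
        refine lintegral_congr fun w => ?_
        rw [← lintegral_const_mul]
        · refine lintegral_congr fun u => ?_
          rw [← mul_assoc, hb.bayes n h1 hn z₀ h0, mul_assoc]
        · exact (hB w).mul (hh'.comp (measurable_id.prodMk measurable_const))

/-- Joint law of the initial and the last state. -/
lemma IsBridge.lintegral_path_last (hb : IsBridge ν a F Q B T) {n : ℕ} (hn : n < T)
    {h : E → E → ℝ≥0∞} (hh : Measurable fun p : E × E => h p.1 p.2) :
    ∫⁻ z : Fin (n + 2) → E, a (z 0) * pathProd F (n + 1) z * h (z 0) (z (Fin.last _))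
        ∂(Measure.pi fun _ => ν) =
      ∫⁻ z₀, a z₀ * ∫⁻ w, Q (n + 1) z₀ w * h z₀ w ∂ν ∂ν := by
  induction n generalizing h with
  | zero =>
    have hz : Measurable fun z : Fin (0 + 2) → E => (z 0, z (Fin.last _)) := by fun_prop
    have hh2 := hh.comp hz
    simp only [Function.comp_def] at hh2
    rw [lintegral_path_succ ν hb.meas_init hb.meas_step hh2]
    simp only [snoc_zero', Fin.snoc_last]
    refine (lintegral_path_zero ν (h := fun u => ∫⁻ v, F 0 u v * h u v ∂ν)).trans ?_
    refine lintegral_congr fun z₀ => ?_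
    by_cases h0 : a z₀ = 0
    · simp [h0]
    simp_rw [zero_add, hb.multi_one z₀ h0]
  | succ n ih =>
    have hz : Measurable fun z : Fin (n + 1 + 2) → E => (z 0, z (Fin.last _)) := by fun_prop
    have hh2 := hh.comp hz
    simp only [Function.comp_def] at hh2
    rw [lintegral_path_succ ν hb.meas_init hb.meas_step hh2]
    simp only [snoc_zero', Fin.snoc_last]
    have hm : Measurable fun p : E × E => ∫⁻ v, F (n + 1) p.2 v * h p.1 v ∂ν := by
      have h1 : Measurable fun q : (E × E) × E => F (n + 1) q.1.2 q.2 * h q.1.1 q.2 :=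
        ((hb.meas_step _).comp ((measurable_snd.comp measurable_fst).prodMk measurable_snd)).mul
          (hh.comp ((measurable_fst.comp measurable_fst).prodMk measurable_snd))
      exact h1.lintegral_prod_right'
    refine (ih (h := fun z₀ u => ∫⁻ v, F (n + 1) u v * h z₀ v ∂ν) (by omega) hm).trans ?_
    -- The integrand ignores the intermediate state, so after the swap the bridge only contributes
    -- its total mass.
    refine (hb.lintegral_swap (n := n + 1) (by omega) hn (h := fun z₀ _ w => h z₀ w) ?_).trans ?_
    · exact hh.comp (measurable_fst.prodMk (measurable_snd.comp measurable_snd))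
    refine lintegral_congr fun z₀ => ?_
    by_cases h0 : a z₀ = 0
    · simp [h0]
    congr 1
    refine lintegral_congr fun w => ?_
    -- Where the multi-step density vanishes the bridge need not be normalized, but its weight is
    -- zero.
    by_cases hw : Q (n + 1 + 1) z₀ w = 0
    · simp [hw]
    have hB : Measurable fun u => B (n + 1) z₀ w u :=
      (hb.meas_bridge _).comp (measurable_const.prodMk (measurable_const.prodMk measurable_id))
    rw [lintegral_mul_const _ hB, hb.bridge_one _ (by omega) hn z₀ h0 w hw, one_mul]

/-- Joint law of the initial state and the last two states. -/
lemma IsBridge.lintegral_path_last_two (hb : IsBridge ν a F Q B T) {n : ℕ} (hn : n + 1 < T)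
    {h : E → E → E → ℝ≥0∞} (hh : Measurable fun p : E × E × E => h p.1 p.2.1 p.2.2) :
    ∫⁻ z : Fin (n + 3) → E, a (z 0) * pathProd F (n + 2) z *
        h (z 0) (z (Fin.last _).castSucc) (z (Fin.last _)) ∂(Measure.pi fun _ => ν) =
      ∫⁻ z₀, a z₀ * ∫⁻ w, Q (n + 2) z₀ w * ∫⁻ u, B (n + 1) z₀ w u * h z₀ u w ∂ν ∂ν ∂ν := by
  have hz : Measurable fun z : Fin (n + 3) → E =>
      (z 0, z (Fin.last _).castSucc, z (Fin.last _)) := by fun_prop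
  have hh2 := hh.comp hz
  simp only [Function.comp_def] at hh2
  rw [lintegral_path_succ ν hb.meas_init hb.meas_step hh2]
  simp only [snoc_zero', Fin.snoc_last, Fin.snoc_castSucc]
  have hm : Measurable fun p : E × E => ∫⁻ v, F (n + 1) p.2 v * h p.1 p.2 v ∂ν := by
    have h1 : Measurable fun q : (E × E) × E => F (n + 1) q.1.2 q.2 * h q.1.1 q.1.2 q.2 :=
      ((hb.meas_step _).comp ((measurable_snd.comp measurable_fst).prodMk measurable_snd)).mul
        (hh.comp ((measurable_fst.comp measurable_fst).prodMk
          ((measurable_snd.comp measurable_fst).prodMk measurable_snd)))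
    exact h1.lintegral_prod_right'
  exact (hb.lintegral_path_last (h := fun z₀ u => ∫⁻ v, F (n + 1) u v * h z₀ u v ∂ν)
    (by omega) hm).trans (hb.lintegral_swap (by omega) hn hh)

/-- Total mass of a path density which is normalized backwards in time on a family of good
states. -/
lemma lintegral_path_backward {R : ℕ → E → E → ℝ≥0∞}
    (hR : ∀ k, Measurable fun p : E × E => R k p.1 p.2) {T : ℕ} (good : ℕ → E → Prop)
    (hgood : ∀ k < T, ∀ w, good (k + 1) w → ∀ u, R k w u ≠ 0 → good k u)
    (hR1 : ∀ k < T, ∀ w, good (k + 1) w → ∫⁻ u, R k w u ∂ν = 1)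
    {b : E → ℝ≥0∞} (hbm : Measurable b) (hb : ∀ w, b w ≠ 0 → good T w) :
    ∫⁻ z : Fin (T + 1) → E, b (z (Fin.last T)) * pathProd (fun k u w => R k w u) T z
        ∂(Measure.pi fun _ => ν) = ∫⁻ w, b w ∂ν := by
  induction T generalizing b with
  | zero =>
    refine Eq.trans (lintegral_congr fun z => ?_)
      ((lintegral_path_zero ν (a := b) (F := R) (h := fun _ => 1)).trans (by simp))
    simp [pathProd]
  | succ T ih =>
    have hRs : ∀ k, Measurable fun p : E × E => R k p.2 p.1 := fun k =>
      (hR k).comp measurable_swap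
    have h1 := lintegral_path_succ ν (a := fun _ => (1 : ℝ≥0∞)) (F := fun k u w => R k w u)
      measurable_const hRs (n := T) (H := fun z => b (z (Fin.last _))) (by fun_prop)
    simp only [one_mul, Fin.snoc_last] at h1
    simp_rw [mul_comm (b _)]
    rw [h1]
    have hm : Measurable fun p : (Fin (T + 1) → E) × E => R T p.2 (p.1 (Fin.last T)) * b p.2 :=
      ((hR T).comp (measurable_snd.prodMk ((measurable_pi_apply _).comp measurable_fst))).mul
        (hbm.comp measurable_snd)
    have hp := measurable_pathProd (F := fun k u w => R k w u) hRs T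
    calc ∫⁻ z : Fin (T + 1) → E, pathProd (fun k u w => R k w u) T z *
            ∫⁻ v, R T v (z (Fin.last T)) * b v ∂ν ∂(Measure.pi fun _ => ν)
        = ∫⁻ z : Fin (T + 1) → E, ∫⁻ v, pathProd (fun k u w => R k w u) T z *
            (R T v (z (Fin.last T)) * b v) ∂ν ∂(Measure.pi fun _ => ν) := by
          refine lintegral_congr fun z => (lintegral_const_mul _ ?_).symm
          exact hm.comp (measurable_const.prodMk measurable_id)
      _ = ∫⁻ v, ∫⁻ z : Fin (T + 1) → E, pathProd (fun k u w => R k w u) T z *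
            (R T v (z (Fin.last T)) * b v) ∂(Measure.pi fun _ => ν) ∂ν := by
          refine lintegral_lintegral_swap (Measurable.aemeasurable ?_)
          exact (hp.comp measurable_fst).mul hm
      _ = ∫⁻ v, b v ∂ν := by
          refine lintegral_congr fun v => ?_
          by_cases hv : b v = 0
          · simp [hv]
          have hg := hb v hv
          have hRv : Measurable (R T v) := (hR T).comp (measurable_const.prodMk measurable_id)
          -- With the last state v fixed, the transition into the preceding state plays the role of
          -- the terminal density of a shorter path.
          have := ih (b := R T v) (fun k hk => hgood k (by omega)) (fun k hk => hR1 k (by omega))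
            hRv (hgood T (by omega) v hg)
          rw [hR1 T (by omega) v hg] at this
          have e : ∀ z : Fin (T + 1) → E, pathProd (fun k u w => R k w u) T z *
              (R T v (z (Fin.last T)) * b v) =
              R T v (z (Fin.last T)) * pathProd (fun k u w => R k w u) T z * b v :=
            fun z => by ring
          simp_rw [e]
          rw [lintegral_mul_const _ (by fun_prop), this, one_mul]

end MarkovPath

/-! ### Transitions of a single token -/

section Token

variable {V : ℕ}

lemma oneHot_self (v : Tok V) : oneHot v v = 1 := by simp [oneHot]

lemma oneHot_nonneg (v w : Tok V) : 0 ≤ oneHot v w := by unfold oneHot; split_ifs <;> simp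

lemma sum_oneHot (v : Tok V) : ∑ w, oneHot v w = 1 := by simp [oneHot]

lemma tokForward_nonneg {g : ℝ} (h0 : 0 ≤ g) (h1 : g ≤ 1) (x x' : Tok V) :
    0 ≤ tokForward g x x' := by
  have := oneHot_nonneg x x'
  have := oneHot_nonneg (mask V) x'
  have : 0 ≤ 1 - g := by linarith
  unfold tokForward; split_ifs <;> positivity

lemma sum_tokForward (g : ℝ) (x : Tok V) : ∑ x', tokForward g x x' = 1 := by
  unfold tokForward; split_ifs
  · exact sum_oneHot _
  · rw [Finset.sum_add_distrib, ← Finset.mul_sum, ← Finset.mul_sum, sum_oneHot, sum_oneHot]; ring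

lemma tokForward_zero (x x' : Tok V) : tokForward 0 x x' = oneHot (mask V) x' := by
  simp [tokForward]

lemma tokForward_one (x x' : Tok V) : tokForward 1 x x' = oneHot x x' := by
  unfold tokForward; split_ifs with h <;> simp [h]

lemma tokBridge_nonneg {gs gt : ℝ} (hst : gt ≤ gs) (hs : gs ≤ 1) (x : Tok V) {p : Tok V → ℝ}
    (hp : ∀ v, 0 ≤ p v) (x' : Tok V) : 0 ≤ tokBridge gs gt x p x' := by
  have := oneHot_nonneg x x'
  have := oneHot_nonneg (mask V) x'
  have := hp x'
  have : 0 ≤ 1 - gs := by linarith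
  have : 0 ≤ gs - gt := by linarith
  have : 0 ≤ 1 - gt := by linarith
  unfold tokBridge; split_ifs <;> positivity

lemma sum_tokBridge {gs gt : ℝ} {x : Tok V} {p : Tok V → ℝ} (hp : ∑ v, p v = 1)
    (hx : x = mask V → gt < 1) : ∑ x', tokBridge gs gt x p x' = 1 := by
  unfold tokBridge; split_ifs with h
  · rw [← Finset.sum_div, Finset.sum_add_distrib, ← Finset.mul_sum, ← Finset.mul_sum, sum_oneHot,
      hp, mul_one, mul_one]
    have : 1 - gt ≠ 0 := by linarith [hx h]
    field_simp; ring
  · exact sum_oneHot _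

lemma tokBridge_le_one {gs gt : ℝ} (hst : gt ≤ gs) (hs : gs ≤ 1) (x : Tok V) {p : Tok V → ℝ}
    (hp0 : ∀ v, 0 ≤ p v) (hp : ∑ v, p v = 1) (x' : Tok V) : tokBridge gs gt x p x' ≤ 1 := by
  by_cases hx : x = mask V → gt < 1
  · rw [← sum_tokBridge (gs := gs) hp hx]
    exact Finset.single_le_sum (f := fun v => tokBridge gs gt x p v)
      (fun v _ => tokBridge_nonneg hst hs x hp0 v) (Finset.mem_univ x')
  -- Here γ̄_t = 1 at a masked token, and division by zero makes the bridge 0.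
  · push Not at hx
    have : gt = 1 := le_antisymm (hst.trans hs) hx.2
    simp [tokBridge, hx.1, this]

/-- Bayes' rule for the masking chain started from an ordinary token. -/
lemma tokForward_bayes {gs g : ℝ} (hs : gs ≤ 1) (hg : g ≤ 1) (hs0 : 0 ≤ gs)
    {x₀ : Tok V} (hx₀ : x₀ ≠ mask V) (u w : Tok V) :
    tokForward gs x₀ u * tokForward g u w =
      tokForward (gs * g) x₀ w * tokBridge gs (gs * g) w (oneHot x₀) u := by
  by_cases hw : w = mask V
  · subst hw
    have e : tokForward (gs * g) x₀ (mask V) = 1 - gs * g := by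
      simp [tokForward, hx₀, oneHot, hx₀.symm]
    have hB : (1 - gs * g) * tokBridge gs (gs * g) (mask V) (oneHot x₀) u =
        (1 - gs) * oneHot (mask V) u + (gs - gs * g) * oneHot x₀ u := by
      -- In the 0/0 case gs = g = 1, so both weights on the right vanish and the formula survives.
      by_cases h1 : 1 - gs * g = 0
      · have h2 : gs = 1 := by nlinarith
        have h3 : g = 1 := by rw [h2] at h1; linarith
        simp [h2, h3]
      · simp only [tokBridge, if_true]; field_simp
    rw [e, hB]
    by_cases hu : u = mask V
    · subst hu
      simp [tokForward, hx₀, oneHot, hx₀.symm]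
    · by_cases hux : u = x₀
      · subst hux; simp [tokForward, hx₀, oneHot, Ne.symm hx₀]; ring
      · simp [tokForward, hx₀, oneHot, hu, hux]
  · by_cases hux : w = u
    · subst hux
      by_cases hwx : w = x₀
      · subst hwx; simp [tokForward, tokBridge, oneHot, hw]
      · simp [tokForward, tokBridge, oneHot, hw, hwx, hx₀]
    · by_cases hu : u = mask V
      · simp [tokForward, tokBridge, oneHot, hw, hu, Ne.symm hw]
      · simp [tokForward, tokBridge, oneHot, hw, hu, hux, Ne.symm hux]

lemma tokForward_one_mask {x₀ : Tok V} (hx₀ : x₀ ≠ mask V) : tokForward 1 x₀ (mask V) = 0 := by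
  simp [tokForward, hx₀, oneHot, Ne.symm hx₀]

/-- On the support of the bridge to the ordinary token `x₀`, replacing the clean distribution by
`p` multiplies the transition probability by `p x₀` if the token gets unmasked. -/
lemma tokBridge_eq_mul {gs gt : ℝ} {x₀ : Tok V} (hx₀ : x₀ ≠ mask V) {p : Tok V → ℝ}
    (hp : p (mask V) = 0) {w u : Tok V} (h : tokBridge gs gt w (oneHot x₀) u ≠ 0) :
    tokBridge gs gt w p u = tokBridge gs gt w (oneHot x₀) u *
      (if w = mask V ∧ u ≠ mask V then p x₀ else 1) := by
  unfold tokBridge at *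
  by_cases hw : w = mask V
  · simp only [hw, if_true, true_and] at h ⊢
    by_cases hu : u = mask V
    · simp [hu, hp, oneHot, Ne.symm hx₀]
    · by_cases hux : u = x₀
      · simp [hux, oneHot, hx₀]; ring
      · simp [oneHot, hu, hux] at h
  · simp [hw]

/-- The probability that the bridge unmasks a token. -/
lemma sum_tokBridge_mul_ofReal {gs gt : ℝ} {x₀ : Tok V} (hx₀ : x₀ ≠ mask V)
    (w : Tok V) (c : ℝ≥0∞) :
    ∑ u, ENNReal.ofReal (tokBridge gs gt w (oneHot x₀) u) *
        (if w = mask V ∧ u ≠ mask V then c else 0) =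
      if w = mask V then ENNReal.ofReal ((gs - gt) / (1 - gt)) * c else 0 := by
  by_cases hw : w = mask V
  · simp only [hw, if_true, true_and]
    rw [Finset.sum_eq_single x₀]
    · simp [hx₀, tokBridge, oneHot]
    · intro u _ hu
      by_cases hum : u = mask V
      · simp [hum]
      · simp [tokBridge, oneHot, hu, hum]
    · simp
  · simp [hw]

end Token

/-! ### Products over positions -/

section Product

variable {ι A : Type*} [Fintype ι] [DecidableEq ι] [Fintype A]

lemma sum_prod_eq_one {p : ι → A → ℝ} (hp : ∀ i, ∑ v, p i v = 1) :
    ∑ u : ι → A, ∏ i, p i (u i) = 1 := by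
  have := Finset.prod_univ_sum (fun _ : ι => (Finset.univ : Finset A)) p
  rw [Fintype.piFinset_univ] at this
  rw [← this]
  simp [hp]

/-- Linearity of expectation for independent positions: in the j-th term all factors other than the
j-th sum to one. -/
lemma sum_prod_mul_sum {p φ : ι → A → ℝ≥0∞} (hp : ∀ i, ∑ v, p i v = 1) :
    ∑ u : ι → A, (∏ i, p i (u i)) * ∑ i, φ i (u i) = ∑ i, ∑ v, p i v * φ i v := by
  simp_rw [Finset.mul_sum]
  rw [Finset.sum_comm]
  refine Finset.sum_congr rfl fun j _ => ?_
  -- Placing φ only at position j keeps the summand a product over positions, so sum and product can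
  -- be exchanged.
  have := Finset.prod_univ_sum (fun _ : ι => (Finset.univ : Finset A))
    (fun i v => p i v * if i = j then φ i v else 1)
  rw [Fintype.piFinset_univ] at this
  have h1 : ∀ u : ι → A, ∏ i, (p i (u i) * if i = j then φ i (u i) else 1) =
      (∏ i, p i (u i)) * φ j (u j) := fun u => by
    rw [Finset.prod_mul_distrib, Finset.prod_ite_eq' Finset.univ j]; simp
  simp_rw [h1] at this
  rw [← this, Finset.prod_eq_single j]
  · simp
  · intro i _ hi; simp [hi, hp]
  · simp

end Product

namespace Model

variable {S V d T : ℕ} (M : Model S V d T)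

/-! ### Schedules -/

lemma gamBar_zero : M.gamBar 0 = 1 := by simp [gamBar]

lemma gamBar_succ (t : ℕ) : M.gamBar (t + 1) = M.gamBar t * M.gam (t + 1) :=
  Finset.prod_Icc_succ_top (by omega) _

lemma gamBar_last : M.gamBar T = 0 := M.gam_prod

lemma alphaBar_succ (t : ℕ) : M.alphaBar (t + 1) = M.alphaBar t * M.alpha (t + 1) :=
  Finset.prod_Icc_succ_top (by omega) _

lemma gamBar_nonneg {t : ℕ} (ht : t ≤ T) : 0 ≤ M.gamBar t := by
  refine Finset.prod_nonneg fun s hs => ?_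
  rw [Finset.mem_Icc] at hs
  exact (M.gam_mem s hs.1 (hs.2.trans ht)).1

lemma gamBar_succ_le {t : ℕ} (ht : t < T) : M.gamBar (t + 1) ≤ M.gamBar t := by
  rw [gamBar_succ]
  exact mul_le_of_le_one_right (M.gamBar_nonneg ht.le) (M.gam_mem (t + 1) (by omega) ht).2

lemma gamBar_le_one {t : ℕ} (ht : t ≤ T) : M.gamBar t ≤ 1 := by
  induction t with
  | zero => rw [gamBar_zero]
  | succ t ih => exact (M.gamBar_succ_le ht).trans (ih (by omega))

/-- For T = 0 the empty product γ̄_T would be 1 rather than 0. -/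
lemma one_le_horizon (M : Model S V d T) : 1 ≤ T := by
  by_contra h
  have h0 : T = 0 := by omega
  have h1 := M.gamBar_last
  rw [show M.gamBar T = M.gamBar 0 from congrArg _ h0, gamBar_zero] at h1
  exact one_ne_zero h1

lemma sigmaBarSq_nonneg (t : ℕ) : 0 ≤ M.sigmaBarSq t := by
  induction t with
  | zero => simp [sigmaBarSq]
  | succ t ih => rw [sigmaBarSq]; positivity

lemma sigmaBarSq_pos {t : ℕ} (h1 : 1 ≤ t) (ht : t ≤ T) : 0 < M.sigmaBarSq t := by
  obtain ⟨t, rfl⟩ : ∃ s, t = s + 1 := ⟨t - 1, by omega⟩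
  have := M.sigmaBarSq_nonneg t
  have := M.sigma_pos _ h1 ht
  rw [sigmaBarSq]; positivity

lemma sigma_sq_pos {t : ℕ} (h1 : 1 ≤ t) (ht : t ≤ T) : 0 < M.sigma t ^ 2 :=
  pow_pos (M.sigma_pos _ h1 ht) _

lemma sigmaLat_sq_pos : 0 < M.sigmaLat ^ 2 := pow_pos M.sigmaLat_pos _

lemma bridgeVar_pos {t : ℕ} (h1 : 1 ≤ t) (ht : t < T) : 0 < M.bridgeVar (t + 1) := by
  have := M.sigmaBarSq_pos h1 ht.le
  have := M.sigmaBarSq_pos (t := t + 1) (by omega) ht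
  have := M.sigma_sq_pos (t := t + 1) (by omega) ht
  unfold bridgeVar; simp only [Nat.add_sub_cancel]; positivity

lemma weightX_nonpos {t : ℕ} (ht : t < T) : M.weightX (t + 1) ≤ 0 := by
  unfold weightX
  refine div_nonpos_of_nonpos_of_nonneg ?_ ?_
  · have := M.gamBar_succ_le ht; simp only [Nat.add_sub_cancel]; linarith
  · linarith [M.gamBar_le_one (t := t + 1) ht]

/-! ### Multi-step transitions and bridges of the forward process -/

/-- The law of the tokens at time `t` given the tokens at time `0`. -/
def xMulti (t : ℕ) (x₀ x : TokSeq S V) : ℝ := ∏ i, tokForward (M.gamBar t) (x₀ i) (x i)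

/-- The law of the tokens at time `t` given the tokens at times `t + 1` and `0`. -/
def xBridge (t : ℕ) (x₀ x u : TokSeq S V) : ℝ :=
  ∏ i, tokBridge (M.gamBar t) (M.gamBar (t + 1)) (x i) (oneHot (x₀ i)) (u i)

/-- The density of the latent at time `t` given the latent at time `0`. -/
def yMulti (t : ℕ) (y₀ y : Latent d) : ℝ :=
  gaussDensity (M.alphaBar t • y₀) (M.sigmaBarSq t) y

/-- The density of the latent at time `t` given the latents at times `t + 1` and `0`. -/
def yBridge (t : ℕ) (y₀ y u : Latent d) : ℝ :=
  gaussDensity (M.bridgeMean (t + 1) y y₀) (M.bridgeVar (t + 1)) u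

lemma xForward_nonneg {t : ℕ} (h1 : 1 ≤ t) (ht : t ≤ T) (x x' : TokSeq S V) :
    0 ≤ M.xForward t x x' :=
  Finset.prod_nonneg fun _ _ =>
    tokForward_nonneg (M.gam_mem t h1 ht).1 (M.gam_mem t h1 ht).2 _ _

lemma xMulti_nonneg {t : ℕ} (ht : t ≤ T) (x x' : TokSeq S V) : 0 ≤ M.xMulti t x x' :=
  Finset.prod_nonneg fun _ _ => tokForward_nonneg (M.gamBar_nonneg ht) (M.gamBar_le_one ht) _ _

lemma xBridge_nonneg {t : ℕ} (ht : t < T) (x₀ x u : TokSeq S V) : 0 ≤ M.xBridge t x₀ x u :=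
  Finset.prod_nonneg fun _ _ =>
    tokBridge_nonneg (M.gamBar_succ_le ht) (M.gamBar_le_one ht.le) _ (oneHot_nonneg _) _

lemma yForward_pos {t : ℕ} (h1 : 1 ≤ t) (ht : t ≤ T) (y y' : Latent d) : 0 < M.yForward t y y' :=
  gaussDensity_pos _ (M.sigma_sq_pos h1 ht) _

lemma yMulti_pos {t : ℕ} (h1 : 1 ≤ t) (ht : t ≤ T) (y y' : Latent d) : 0 < M.yMulti t y y' :=
  gaussDensity_pos _ (M.sigmaBarSq_pos h1 ht) _

lemma encoder_pos (x : TokSeq S V) (y : Latent d) : 0 < M.encoder x y :=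
  gaussDensity_pos _ M.sigmaLat_sq_pos _

lemma sum_xForward (t : ℕ) (x : TokSeq S V) : ∑ x', M.xForward t x x' = 1 :=
  sum_prod_eq_one fun _ => sum_tokForward _ _

lemma xMulti_one (x x' : TokSeq S V) : M.xMulti 1 x x' = M.xForward 1 x x' := by
  simp [xMulti, xForward, gamBar]

lemma yMulti_one (y y' : Latent d) : M.yMulti 1 y y' = M.yForward 1 y y' := by
  simp [yMulti, yForward, alphaBar, sigmaBarSq]

lemma xMulti_last (x x' : TokSeq S V) :
    M.xMulti T x x' = if x' = (fun _ => mask V) then 1 else 0 := by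
  simp only [xMulti, gamBar_last, tokForward_zero, oneHot]
  rw [Finset.prod_ite_zero]
  simp [funext_iff]

lemma xBridge_bayes {t : ℕ} (ht : t < T) {x₀ : TokSeq S V} (hx₀ : ∀ i, x₀ i ≠ mask V)
    (u w : TokSeq S V) :
    M.xMulti t x₀ u * M.xForward (t + 1) u w = M.xMulti (t + 1) x₀ w * M.xBridge t x₀ w u := by
  simp only [xMulti, xForward, xBridge, gamBar_succ, ← Finset.prod_mul_distrib]
  exact Finset.prod_congr rfl fun i _ => tokForward_bayes (M.gamBar_le_one ht.le)
    (M.gam_mem (t + 1) (by omega) ht).2 (M.gamBar_nonneg ht.le) (hx₀ i) _ _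

/-- This is `gaussDensity_bayes` with a = α_{t+1}, s = σ̄_t² and r = σ_{t+1}². It starts at t = 1
because σ̄_0 = 0: the law of Y_0 given itself has no density. -/
lemma yBridge_bayes {t : ℕ} (h1 : 1 ≤ t) (ht : t < T) (y₀ u w : Latent d) :
    M.yMulti t y₀ u * M.yForward (t + 1) u w = M.yMulti (t + 1) y₀ w * M.yBridge t y₀ w u := by
  have := gaussDensity_bayes (M.alphaBar t • y₀) u w (M.alpha (t + 1))
    (M.sigmaBarSq_pos h1 ht.le) (M.sigma_sq_pos (t := t + 1) (by omega) ht)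
  rw [yMulti, yForward, this, yMulti, yBridge, bridgeMean, bridgeVar, Nat.add_sub_cancel,
    smul_smul, smul_smul, alphaBar_succ, mul_comm (M.alpha _) (M.alphaBar _), sigmaBarSq,
    div_mul_eq_mul_div, mul_comm (M.sigma _ ^ 2) (M.alphaBar _)]

/-- A sequence reached with positive probability has masked positions only if masking has
started. -/
lemma gamBar_lt_one_of_xMulti_ne_zero {t : ℕ} (ht : t ≤ T) {x₀ x : TokSeq S V}
    (hx₀ : ∀ i, x₀ i ≠ mask V) (h : M.xMulti t x₀ x ≠ 0) {i : Fin S} (hi : x i = mask V) :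
    M.gamBar t < 1 := by
  refine lt_of_le_of_ne (M.gamBar_le_one ht) fun h1 => ?_
  have := Finset.prod_ne_zero_iff.1 h i (Finset.mem_univ _)
  rw [h1, hi, tokForward_one_mask (hx₀ i)] at this
  exact this rfl

lemma sum_xBridge {t : ℕ} (ht : t < T) {x₀ x : TokSeq S V} (hx₀ : ∀ i, x₀ i ≠ mask V)
    (h : M.xMulti (t + 1) x₀ x ≠ 0) : ∑ u, M.xBridge t x₀ x u = 1 :=
  sum_prod_eq_one fun _ => sum_tokBridge (sum_oneHot _) fun hi =>
    M.gamBar_lt_one_of_xMulti_ne_zero (t := t + 1) ht hx₀ h hi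

end Model

/-! ### Integration and measurability on joint states -/

section State

variable {S V d : ℕ}

lemma lintegral_state {h : State S V d → ℝ≥0∞} (hh : Measurable h) :
    ∫⁻ z, h z ∂((Measure.count : Measure (TokSeq S V)).prod volume) = ∑ x, ∫⁻ y, h (x, y) := by
  rw [lintegral_prod _ hh.aemeasurable, lintegral_count, tsum_fintype]

lemma measurable_tokSeq₂ {α : Type*} [MeasurableSpace α] (φ : TokSeq S V → TokSeq S V → ℝ)
    {x x' : α → TokSeq S V} (hx : Measurable x) (hx' : Measurable x') :
    Measurable fun a => φ (x a) (x' a) :=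
  (measurable_of_countable (Function.uncurry φ)).comp (hx.prodMk hx')

end State

namespace Model

variable {S V d T : ℕ} (M : Model S V d T)

/-! ### Measurability -/

lemma measurable_xReverse (t : ℕ) :
    Measurable fun p : State S V d × TokSeq S V => M.xReverse t p.1 p.2 := by
  refine measurable_from_prod_countable_left fun x' => ?_
  unfold xReverse tokBridge
  refine Finset.measurable_prod _ fun i _ => ?_
  have hi : Measurable fun z : State S V d => z.1 i := by fun_prop
  refine Measurable.ite (hi (measurableSet_singleton _)) ?_ ?_
  · have := M.xDen_measurable t i (x' i)
    dsimp only
    fun_prop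
  · exact (measurable_of_countable fun v : Tok V => oneHot v (x' i)).comp hi

lemma measurable_predProb (t : ℕ) :
    Measurable fun p : State S V d × TokSeq S V => M.predProb t p.1 p.2 := by
  refine measurable_from_prod_countable_left fun x' => ?_
  unfold predProb
  refine Finset.measurable_prod _ fun i _ => M.xDen_measurable t i (x' i)

@[fun_prop]
lemma measurable_xReverse_comp {α : Type*} [MeasurableSpace α] (t : ℕ) {z : α → State S V d}
    {x : α → TokSeq S V} (hz : Measurable z) (hx : Measurable x) :
    Measurable fun a => M.xReverse t (z a) (x a) := (M.measurable_xReverse t).comp (hz.prodMk hx)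

@[fun_prop]
lemma measurable_predProb_comp {α : Type*} [MeasurableSpace α] (t : ℕ) {z : α → State S V d}
    {x : α → TokSeq S V} (hz : Measurable z) (hx : Measurable x) :
    Measurable fun a => M.predProb t (z a) (x a) := (M.measurable_predProb t).comp (hz.prodMk hx)

@[fun_prop]
lemma measurable_yDen_comp {α : Type*} [MeasurableSpace α] (t : ℕ) {z : α → State S V d}
    (hz : Measurable z) : Measurable fun a => M.yDen t (z a) := (M.yDen_measurable t).comp hz

@[fun_prop]
lemma measurable_bridgeMean_comp {α : Type*} [MeasurableSpace α] (t : ℕ) {y y' : α → Latent d}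
    (hy : Measurable y) (hy' : Measurable y') :
    Measurable fun a => M.bridgeMean t (y a) (y' a) := by
  unfold bridgeMean; fun_prop

@[fun_prop]
lemma measurable_yReverse_comp {α : Type*} [MeasurableSpace α] (t : ℕ) {z : α → State S V d}
    {y : α → Latent d} (hz : Measurable z) (hy : Measurable y) :
    Measurable fun a => M.yReverse t (z a) (y a) := by
  unfold yReverse
  split_ifs <;> fun_prop

@[fun_prop]
lemma measurable_xForward_comp {α : Type*} [MeasurableSpace α] (t : ℕ)
    {x x' : α → TokSeq S V} (hx : Measurable x) (hx' : Measurable x') :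
    Measurable fun a => M.xForward t (x a) (x' a) := measurable_tokSeq₂ _ hx hx'

@[fun_prop]
lemma measurable_xMulti_comp {α : Type*} [MeasurableSpace α] (t : ℕ)
    {x x' : α → TokSeq S V} (hx : Measurable x) (hx' : Measurable x') :
    Measurable fun a => M.xMulti t (x a) (x' a) := measurable_tokSeq₂ _ hx hx'

/-! ### The forward process as a Markov chain -/

/-- The density of `Z_0` given `X_0 = x₀`. -/
def fwdInit (x₀ : TokSeq S V) (z : State S V d) : ℝ≥0∞ :=
  ENNReal.ofReal ((if z.1 = x₀ then 1 else 0) * M.encoder z.1 z.2)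

/-- The density of `Z_{k+1}` given `Z_k`. -/
def fwdStep (k : ℕ) (u w : State S V d) : ℝ≥0∞ :=
  ENNReal.ofReal (M.xForward (k + 1) u.1 w.1 * M.yForward (k + 1) u.2 w.2)

/-- The density of `Z_k` given `Z_0`. -/
def fwdMulti (k : ℕ) (z₀ w : State S V d) : ℝ≥0∞ :=
  ENNReal.ofReal (M.xMulti k z₀.1 w.1 * M.yMulti k z₀.2 w.2)

/-- The density of `Z_k` given `Z_{k+1}` and `Z_0`. -/
def fwdBridge (k : ℕ) (z₀ w u : State S V d) : ℝ≥0∞ :=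
  ENNReal.ofReal (M.xBridge k z₀.1 w.1 u.1 * M.yBridge k z₀.2 w.2 u.2)

lemma measurable_fwdInit (x₀ : TokSeq S V) : Measurable (M.fwdInit x₀) := by
  unfold fwdInit encoder
  refine ENNReal.measurable_ofReal.comp (Measurable.mul ?_ ?_)
  · exact (measurable_of_countable fun x => if x = x₀ then (1 : ℝ) else 0).comp measurable_fst
  · have : Measurable fun z : State S V d => M.encMean z.1 :=
      (measurable_of_countable M.encMean).comp measurable_fst
    fun_prop

lemma measurable_fwdStep (k : ℕ) :
    Measurable fun p : State S V d × State S V d => M.fwdStep k p.1 p.2 := by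
  unfold fwdStep yForward; fun_prop

lemma measurable_fwdMulti (k : ℕ) :
    Measurable fun p : State S V d × State S V d => M.fwdMulti k p.1 p.2 := by
  unfold fwdMulti yMulti; fun_prop

lemma measurable_fwdBridge (k : ℕ) : Measurable
    fun p : State S V d × State S V d × State S V d => M.fwdBridge k p.1 p.2.1 p.2.2 := by
  unfold fwdBridge yBridge
  have h : Measurable fun p : State S V d × State S V d × State S V d =>
      M.xBridge k p.1.1 p.2.1.1 p.2.2.1 :=
    (measurable_of_countable fun q : TokSeq S V × TokSeq S V × TokSeq S V =>
      M.xBridge k q.1 q.2.1 q.2.2).comp (f := fun p : State S V d × State S V d × State S V d =>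
        (p.1.1, p.2.1.1, p.2.2.1)) (by fun_prop)
  fun_prop

/-- Every one-step law of both processes, and every bridge, is a token weight times a Gaussian
density; this is their common normalization. -/
lemma lintegral_mul_gauss {p : TokSeq S V → ℝ} (hp : ∀ x, 0 ≤ p x) (hp1 : ∑ x, p x = 1)
    {m : Latent d} {v : ℝ} (hv : 0 < v) :
    ∫⁻ z : State S V d, ENNReal.ofReal (p z.1 * gaussDensity m v z.2)
      ∂(Measure.count.prod volume) = 1 := by
  rw [lintegral_state]
  · simp_rw [ENNReal.ofReal_mul (hp _)]
    have : ∀ x, ∫⁻ y : Latent d, ENNReal.ofReal (p x) * ENNReal.ofReal (gaussDensity m v y) =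
        ENNReal.ofReal (p x) := fun x => by
      rw [lintegral_const_mul _ (by fun_prop), lintegral_gaussDensity _ hv, mul_one]
    simp_rw [this]
    rw [← ENNReal.ofReal_sum_of_nonneg fun x _ => hp x, hp1, ENNReal.ofReal_one]
  · have : Measurable fun z : State S V d => p z.1 :=
      (measurable_of_countable p).comp measurable_fst
    fun_prop

lemma lintegral_fwdInit (x₀ : TokSeq S V) :
    ∫⁻ z, M.fwdInit x₀ z ∂(Measure.count.prod volume) = 1 := by
  refine Eq.trans (lintegral_congr fun z => ?_) (lintegral_mul_gauss
    (p := fun x => if x = x₀ then 1 else 0) (m := M.encMean x₀) (v := M.sigmaLat ^ 2)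
    (fun x => by split_ifs <;> simp) (by simp) M.sigmaLat_sq_pos)
  unfold fwdInit encoder
  split_ifs with h <;> simp [h]

lemma lintegral_fwdStep {k : ℕ} (hk : k < T) (u : State S V d) :
    ∫⁻ w, M.fwdStep k u w ∂(Measure.count.prod volume) = 1 :=
  lintegral_mul_gauss (M.xForward_nonneg (by omega) hk _) (M.sum_xForward _ _)
    (M.sigma_sq_pos (by omega) hk)

lemma fst_eq_of_fwdInit_ne_zero {x₀ : TokSeq S V} {z : State S V d} (h : M.fwdInit x₀ z ≠ 0) :
    z.1 = x₀ := by
  by_contra hne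
  simp [fwdInit, hne] at h

/-- Given Z_0 the two channels are independent, so Bayes' rule for the pair is the product of the
rules for tokens and latents. The initial density forces the tokens of z₀ to be `x₀`, which has no
mask. -/
lemma isBridge {x₀ : TokSeq S V} (hx₀ : ∀ i, x₀ i ≠ mask V) :
    IsBridge (Measure.count.prod volume) (M.fwdInit x₀) M.fwdStep M.fwdMulti M.fwdBridge T where
  meas_init := M.measurable_fwdInit x₀
  meas_step := M.measurable_fwdStep
  meas_multi := M.measurable_fwdMulti
  meas_bridge := M.measurable_fwdBridge
  step_one k hk u := M.lintegral_fwdStep hk u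
  multi_one z₀ _ u := by simp only [fwdMulti, fwdStep, xMulti_one, yMulti_one, zero_add]
  bayes k h1 hk z₀ h0 u w := by
    obtain rfl := M.fst_eq_of_fwdInit_ne_zero h0
    unfold fwdMulti fwdStep fwdBridge
    rw [← ENNReal.ofReal_mul, ← ENNReal.ofReal_mul, mul_mul_mul_comm, M.xBridge_bayes hk hx₀,
      M.yBridge_bayes h1 hk, mul_mul_mul_comm]
    · exact mul_nonneg (M.xMulti_nonneg hk _ _) (M.yMulti_pos (by omega) hk _ _).le
    · exact mul_nonneg (M.xMulti_nonneg hk.le _ _) (M.yMulti_pos h1 hk.le _ _).le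
  bridge_one k h1 hk z₀ h0 w hw := by
    obtain rfl := M.fst_eq_of_fwdInit_ne_zero h0
    refine lintegral_mul_gauss (M.xBridge_nonneg hk _ _) (M.sum_xBridge hk hx₀ fun h => hw ?_)
      (M.bridgeVar_pos h1 hk)
    simp [fwdMulti, h]

/-- The density of the forward path given `X_0 = x₀`. -/
def fwdDensity (x₀ : TokSeq S V) (z : Path S V d T) : ℝ :=
  (if (z 0).1 = x₀ then 1 else 0) * M.encoder (z 0).1 (z 0).2 *
    ∏ k : Fin T, (M.xForward (k + 1) (z k.castSucc).1 (z k.succ).1 *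
      M.yForward (k + 1) (z k.castSucc).2 (z k.succ).2)

lemma condForwardLaw_eq (x₀ : TokSeq S V) : M.condForwardLaw x₀ =
    (pathRef S V d T).withDensity fun z => ENNReal.ofReal (M.fwdDensity x₀ z) := rfl

lemma fwdStep_nonneg (z : Path S V d T) (k : Fin T) :
    0 ≤ M.xForward (k + 1) (z k.castSucc).1 (z k.succ).1 *
      M.yForward (k + 1) (z k.castSucc).2 (z k.succ).2 :=
  mul_nonneg (M.xForward_nonneg (by omega) (by omega) _ _)
    (M.yForward_pos (by omega) (by omega) _ _).le

lemma fwdDensity_nonneg (x₀ : TokSeq S V) (z : Path S V d T) : 0 ≤ M.fwdDensity x₀ z := by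
  refine mul_nonneg (mul_nonneg (by split_ifs <;> simp) (M.encoder_pos _ _).le) ?_
  exact Finset.prod_nonneg fun k _ => M.fwdStep_nonneg z k

lemma ofReal_fwdDensity (x₀ : TokSeq S V) (z : Path S V d T) :
    ENNReal.ofReal (M.fwdDensity x₀ z) = M.fwdInit x₀ (z 0) * pathProd M.fwdStep T z := by
  rw [fwdDensity, ENNReal.ofReal_mul
    (mul_nonneg (by split_ifs <;> simp) (M.encoder_pos _ _).le),
    ENNReal.ofReal_prod_of_nonneg fun k _ => M.fwdStep_nonneg z k]
  rfl

lemma measurable_fwdDensity (x₀ : TokSeq S V) : Measurable (M.fwdDensity x₀) := by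
  unfold fwdDensity encoder yForward
  have : Measurable fun z : Path S V d T => M.encMean (z 0).1 :=
    (measurable_of_countable M.encMean).comp (by fun_prop)
  have h2 : Measurable fun z : Path S V d T => if (z 0).1 = x₀ then (1 : ℝ) else 0 :=
    (measurable_of_countable fun x => if x = x₀ then (1 : ℝ) else 0).comp (by fun_prop)
  fun_prop

lemma lintegral_condForwardLaw (x₀ : TokSeq S V) (H : Path S V d T → ℝ≥0∞) :
    ∫⁻ z, H z ∂M.condForwardLaw x₀ =
      ∫⁻ z, M.fwdInit x₀ (z 0) * pathProd M.fwdStep T z * H z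
        ∂(Measure.pi fun _ => Measure.count.prod volume) := by
  rw [condForwardLaw_eq, lintegral_withDensity_eq_lintegral_mul_non_measurable _
    (M.measurable_fwdDensity x₀).ennreal_ofReal (ae_of_all _ fun _ => ENNReal.ofReal_lt_top)]
  refine lintegral_congr fun z => ?_
  rw [Pi.mul_apply, ofReal_fwdDensity]

lemma lintegral_condForwardLaw_init (x₀ : TokSeq S V) {h : State S V d → ℝ≥0∞}
    (hh : Measurable h) : ∫⁻ z, h (at_ z 0) ∂M.condForwardLaw x₀ =
      ∫⁻ z, M.fwdInit x₀ z * h z ∂(Measure.count.prod volume) := by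
  rw [lintegral_condForwardLaw]
  refine (lintegral_path_restrict (Measure.count.prod volume) (M.measurable_fwdInit x₀)
    M.measurable_fwdStep (Nat.zero_le T) (fun k _ hk u => M.lintegral_fwdStep hk u)
    (H := fun z => h (z 0)) (by fun_prop)).trans ?_
  exact lintegral_path_zero _

instance (x₀ : TokSeq S V) : IsProbabilityMeasure (M.condForwardLaw x₀) := by
  constructor
  rw [← lintegral_one]
  exact (M.lintegral_condForwardLaw_init x₀ measurable_const).trans
    (by simpa using M.lintegral_fwdInit x₀)

lemma at_eq (z : Path S V d T) {t : ℕ} (ht : t < T + 1) : at_ z t = z ⟨t, ht⟩ := by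
  unfold at_; congr 1; exact Fin.ext (Nat.mod_eq_of_lt ht)

lemma at_castSucc (z : Path S V d T) (k : Fin T) : z k.castSucc = at_ z k :=
  (at_eq z (by omega)).symm

lemma at_succ (z : Path S V d T) (k : Fin T) : z k.succ = at_ z (k + 1) :=
  (at_eq z (by omega)).symm

@[fun_prop]
lemma measurable_at (t : ℕ) : Measurable fun z : Path S V d T => at_ z t := by
  unfold at_; fun_prop

/-- Joint law of the states at times `0` and `n + 1`. -/
lemma lintegral_condForwardLaw_pair {x₀ : TokSeq S V} (hx₀ : ∀ i, x₀ i ≠ mask V) {n : ℕ}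
    (hn : n < T) {h : State S V d → State S V d → ℝ≥0∞}
    (hh : Measurable fun p : State S V d × State S V d => h p.1 p.2) :
    ∫⁻ z, h (at_ z 0) (at_ z (n + 1)) ∂M.condForwardLaw x₀ =
      ∫⁻ z₀, M.fwdInit x₀ z₀ * ∫⁻ w, M.fwdMulti (n + 1) z₀ w * h z₀ w
        ∂(Measure.count.prod volume) ∂(Measure.count.prod volume) := by
  have hz : Measurable fun z : Fin (n + 2) → State S V d => (z 0, z (Fin.last _)) := by fun_prop
  rw [lintegral_condForwardLaw, ← (M.isBridge hx₀).lintegral_path_last hn hh]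
  refine Eq.trans ?_ (lintegral_path_restrict (T := T) (n := n + 1) (Measure.count.prod volume)
    (M.measurable_fwdInit x₀) M.measurable_fwdStep hn
    (fun k _ hk u => M.lintegral_fwdStep hk u) (hh.comp hz))
  refine lintegral_congr fun z => ?_
  rw [at_eq z (by omega), at_eq z (show n + 1 < T + 1 by omega)]
  rfl

/-- The conditional law of the state at time `n + 1` given those at times `0` and `n + 2` is the
bridge. -/
lemma lintegral_condForwardLaw_bridge {x₀ : TokSeq S V} (hx₀ : ∀ i, x₀ i ≠ mask V) {n : ℕ}
    (hn : n + 1 < T) {h : State S V d → State S V d → State S V d → ℝ≥0∞}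
    (hh : Measurable fun p : State S V d × State S V d × State S V d => h p.1 p.2.1 p.2.2)
    {g : State S V d → State S V d → ℝ≥0∞}
    (hg : Measurable fun p : State S V d × State S V d => g p.1 p.2)
    (hgh : ∀ z₀ w, z₀.1 = x₀ → M.xMulti (n + 2) z₀.1 w.1 ≠ 0 →
      ∫⁻ u, M.fwdBridge (n + 1) z₀ w u * h z₀ u w ∂(Measure.count.prod volume) = g z₀ w) :
    ∫⁻ z, h (at_ z 0) (at_ z (n + 1)) (at_ z (n + 2)) ∂M.condForwardLaw x₀ =
      ∫⁻ z, g (at_ z 0) (at_ z (n + 2)) ∂M.condForwardLaw x₀ := by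
  have hz : Measurable fun z : Fin (n + 3) → State S V d =>
      (z 0, z (Fin.last _).castSucc, z (Fin.last _)) := by fun_prop
  rw [M.lintegral_condForwardLaw_pair hx₀ hn hg]
  refine Eq.trans ?_ (((M.isBridge hx₀).lintegral_path_last_two hn hh).trans ?_)
  · rw [lintegral_condForwardLaw]
    refine Eq.trans ?_ (lintegral_path_restrict (T := T) (n := n + 2)
      (Measure.count.prod volume) (M.measurable_fwdInit x₀) M.measurable_fwdStep hn
      (fun k _ hk u => M.lintegral_fwdStep hk u) (hh.comp hz))
    refine lintegral_congr fun z => ?_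
    rw [at_eq z (by omega), at_eq z (show n + 1 < T + 1 by omega),
      at_eq z (show n + 2 < T + 1 by omega)]
    rfl
  · refine lintegral_congr fun z₀ => ?_
    by_cases h0 : M.fwdInit x₀ z₀ = 0
    · simp [h0]
    congr 1
    refine lintegral_congr fun w => ?_
    by_cases hw : M.xMulti (n + 2) z₀.1 w.1 = 0
    · simp [fwdMulti, hw]
    · rw [hgh z₀ w (M.fst_eq_of_fwdInit_ne_zero h0) hw]

end Model

/-! ### Gaussian laws -/

section GaussLaw

variable {d : ℕ}

lemma isProbabilityMeasure_gaussLaw (μ : Latent d) {v : ℝ} (hv : 0 < v) :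
    IsProbabilityMeasure (gaussLaw μ v) := by
  constructor
  rw [gaussLaw, withDensity_apply _ MeasurableSet.univ, Measure.restrict_univ,
    lintegral_gaussDensity μ hv]

lemma lintegral_gaussLaw (μ : Latent d) (v : ℝ) (h : Latent d → ℝ≥0∞) :
    ∫⁻ y, h y ∂gaussLaw μ v = ∫⁻ y, ENNReal.ofReal (gaussDensity μ v y) * h y := by
  rw [gaussLaw, lintegral_withDensity_eq_lintegral_mul_non_measurable _
    (measurable_gaussDensity measurable_const measurable_id' v).ennreal_ofReal
    (ae_of_all _ fun _ => ENNReal.ofReal_lt_top)]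
  rfl

lemma measurable_gaussLaw_smul (a v : ℝ) : Measurable fun y : Latent d => gaussLaw (a • y) v := by
  refine Measure.measurable_of_measurable_coe _ fun s hs => ?_
  simp_rw [gaussLaw, withDensity_apply _ hs]
  have : Measurable fun p : Latent d × Latent d =>
      ENNReal.ofReal (gaussDensity (a • p.1) v p.2) := by
    fun_prop
  exact this.lintegral_prod_right'

/-- Bayes' rule makes the integral over u trivial: the posterior of u given w integrates to one and
only the law of w remains. -/
lemma gaussLaw_bind (m : Latent d) (a : ℝ) {s r : ℝ} (hs : 0 < s) (hr : 0 < r) :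
    (gaussLaw m s).bind (fun u => gaussLaw (a • u) r) = gaussLaw (a • m) (a ^ 2 * s + r) := by
  ext A hA
  rw [Measure.bind_apply hA (measurable_gaussLaw_smul a r).aemeasurable, lintegral_gaussLaw]
  simp_rw [gaussLaw, withDensity_apply _ hA]
  have hv : 0 < a ^ 2 * s + r := by positivity
  calc ∫⁻ u, ENNReal.ofReal (gaussDensity m s u) *
        ∫⁻ w in A, ENNReal.ofReal (gaussDensity (a • u) r w)
      = ∫⁻ u, ∫⁻ w in A, ENNReal.ofReal (gaussDensity m s u) *
          ENNReal.ofReal (gaussDensity (a • u) r w) := by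
        refine lintegral_congr fun u => (lintegral_const_mul _ (by fun_prop)).symm
    _ = ∫⁻ w in A, ∫⁻ u, ENNReal.ofReal (gaussDensity m s u) *
          ENNReal.ofReal (gaussDensity (a • u) r w) :=
        lintegral_lintegral_swap (Measurable.aemeasurable (by fun_prop))
    _ = _ := by
        refine lintegral_congr fun w => ?_
        simp_rw [← ENNReal.ofReal_mul (gaussDensity_nonneg m hs _),
          gaussDensity_bayes m _ w a hs hr, ENNReal.ofReal_mul (gaussDensity_nonneg _ hv _)]
        rw [lintegral_const_mul _ (by fun_prop), lintegral_gaussDensity _ (by positivity), mul_one]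

/-- The main computation in miniature: N is the scaled squared distance to μ, with mean d/2, and
-log Φ is the one to μ', with mean d/2 plus the squared difference of means. The finite d/2 cancels.
-/
lemma klDiv_gaussLaw (μ μ' : Latent d) {v : ℝ} (hv : 0 < v) :
    InformationTheory.klDiv (gaussLaw μ v) (gaussLaw μ' v) =
      ENNReal.ofReal (‖μ - μ'‖ ^ 2 / (2 * v)) := by
  have h1 := isProbabilityMeasure_gaussLaw μ hv
  have h2 := isProbabilityMeasure_gaussLaw μ' hv
  have hN : ∫⁻ y, ENNReal.ofReal (‖y - μ‖ ^ 2 / (2 * v)) ∂gaussLaw μ v =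
      ENNReal.ofReal (d / 2) := by
    rw [lintegral_gaussLaw, lintegral_gaussDensity_mul_sq _ _ hv]; simp
  have hμ : ∀ m : Latent d, gaussLaw m v =
    volume.withDensity fun y => ENNReal.ofReal (gaussDensity m v y) := fun _ => rfl
  rw [hμ] at h1 h2
  have h := klDiv_withDensity_add (volume : Measure (Latent d)) (f := gaussDensity μ v)
    (g := gaussDensity μ' v) (N := fun y => ‖y - μ‖ ^ 2 / (2 * v))
    (Φ := fun y => Real.exp (-(‖y - μ'‖ ^ 2 / (2 * v))))
    (measurable_gaussDensity measurable_const measurable_id v)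
    (measurable_gaussDensity measurable_const measurable_id v) (by fun_prop) (by fun_prop)
    (gaussDensity_nonneg _ hv) (gaussDensity_nonneg _ hv) (fun y => by positivity)
    (fun y => by positivity)
    (fun y _ => by rw [Real.exp_le_one_iff, neg_nonpos]; positivity)
    (by rw [← hμ, hN]; simp) (fun y _ => gaussDensity_eq_mul_exp _ _ _ _)
  simp only [← hμ, negLog_exp_neg] at h
  rw [hN, lintegral_gaussLaw, lintegral_gaussDensity_mul_sq _ _ hv, add_comm] at h
  exact (ENNReal.add_right_inj (by simp)).1 h

end GaussLaw

/-! ### Closed forms of the multi-step marginals and of the losses at time T -/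

lemma tokForward_comp {V : ℕ} (g h : ℝ) (x w : Tok V) :
    ∑ u, tokForward g x u * tokForward h u w = tokForward (g * h) x w := by
  by_cases hx : x = mask V
  · subst hx
    rw [Finset.sum_eq_single (mask V)]
    · simp [tokForward, oneHot]
    · intro u _ hu; simp [tokForward, oneHot, hu]
    · simp
  · have : ∀ u, tokForward g x u = g * oneHot x u + (1 - g) * oneHot (mask V) u := fun u => by
      simp [tokForward, hx]
    simp_rw [this, add_mul, Finset.sum_add_distrib, mul_assoc, ← Finset.mul_sum]
    simp only [oneHot, ite_mul, one_mul, zero_mul, Finset.sum_ite_eq', Finset.mem_univ, if_true]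
    simp only [tokForward, hx, if_true, if_false]
    ring

namespace Model

variable {S V d T : ℕ} (M : Model S V d T)

lemma yMarginal_eq {t : ℕ} (h1 : 1 ≤ t) (ht : t ≤ T) (y : Latent d) :
    M.yMarginal t y = gaussLaw (M.alphaBar t • y) (M.sigmaBarSq t) := by
  induction t, h1 using Nat.le_induction with
  | base =>
    rw [yMarginal, yMarginal, Measure.dirac_bind (measurable_gaussLaw_smul _ _)]
    simp [alphaBar, sigmaBarSq]
  | succ t h1 ih =>
    rw [yMarginal, ih (by omega), gaussLaw_bind _ _ (M.sigmaBarSq_pos h1 (by omega))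
      (M.sigma_sq_pos (by omega) ht), smul_smul, alphaBar_succ, mul_comm, sigmaBarSq]

lemma xMulti_comp (t : ℕ) (x w : TokSeq S V) :
    ∑ u, M.xMulti t x u * M.xForward (t + 1) u w = M.xMulti (t + 1) x w := by
  have := Finset.prod_univ_sum (fun _ : Fin S => (Finset.univ : Finset (Tok V)))
    (fun i v => tokForward (M.gamBar t) (x i) v * tokForward (M.gam (t + 1)) v (w i))
  rw [Fintype.piFinset_univ] at this
  simp only [xMulti, xForward, ← Finset.prod_mul_distrib, ← this, tokForward_comp, gamBar_succ]

lemma xMarginal_eq {t : ℕ} (ht : t ≤ T) (x : TokSeq S V) :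
    M.xMarginal t x = Measure.count.withDensity fun w => ENNReal.ofReal (M.xMulti t x w) := by
  induction t with
  | zero =>
    refine Measure.ext_of_singleton fun w => ?_
    rw [xMarginal, withDensity_apply _ (measurableSet_singleton _), lintegral_singleton,
      Measure.count_singleton, mul_one, Measure.dirac_apply' _ (measurableSet_singleton _)]
    simp only [xMulti, gamBar_zero, tokForward_one, oneHot]
    rw [Finset.prod_ite_zero]
    by_cases h : x = w
    · simp [h]
    · have : ¬ ∀ i, w i = x i := fun h' => h (funext fun i => (h' i).symm)
      simp [h, this]
  | succ t ih =>
    refine Measure.ext_of_singleton fun w => ?_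
    rw [xMarginal, Measure.bind_apply (measurableSet_singleton _)
      (measurable_of_countable _).aemeasurable, ih (by omega),
      lintegral_withDensity_eq_lintegral_mul _ (measurable_of_countable _)
        (measurable_of_countable _), lintegral_count, tsum_fintype]
    simp only [Pi.mul_apply, withDensity_apply _ (measurableSet_singleton _), lintegral_singleton,
      Measure.count_singleton, mul_one]
    simp_rw [← ENNReal.ofReal_mul (M.xMulti_nonneg (t := t) (by omega) _ _)]
    rw [← ENNReal.ofReal_sum_of_nonneg fun u _ => mul_nonneg
      (M.xMulti_nonneg (by omega) _ _) (M.xForward_nonneg (by omega) ht _ _), xMulti_comp]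

lemma xMarginal_last (x : TokSeq S V) :
    M.xMarginal T x = Measure.dirac fun _ => mask V := by
  rw [M.xMarginal_eq le_rfl]
  refine Measure.ext_of_singleton fun w => ?_
  rw [withDensity_apply _ (measurableSet_singleton _), lintegral_singleton,
    Measure.count_singleton, mul_one, Measure.dirac_apply' _ (measurableSet_singleton _),
    xMulti_last]
  by_cases h : w = fun _ => mask V
  · simp [h]
  · simp [h, Ne.symm h]

lemma lossXT_eq_zero : M.lossXT = 0 := by
  simp [lossXT, xMarginal_last]

lemma lossYT_eq : M.lossYT = ∫⁻ z, ENNReal.ofReal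
    (‖M.alphaBar T • (at_ z 0).2‖ ^ 2 / (2 * M.sigmaBarSq T)) ∂M.forwardLaw := by
  simp_rw [lossYT, M.yMarginal_eq M.one_le_horizon le_rfl,
    klDiv_gaussLaw _ _ (M.sigmaBarSq_pos M.one_le_horizon le_rfl), sub_zero]

/-! ### The generative process -/

lemma xDen_le_one (t : ℕ) (z : State S V d) (i : Fin S) (v : Tok V) : M.xDen t z i v ≤ 1 := by
  rw [← M.xDen_sum t z i]
  exact Finset.single_le_sum (f := fun v => M.xDen t z i v) (fun v _ => M.xDen_nonneg t z i v)
    (Finset.mem_univ v)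

lemma xReverse_nonneg {k : ℕ} (hk : k < T) (z : State S V d) (x : TokSeq S V) :
    0 ≤ M.xReverse (k + 1) z x :=
  Finset.prod_nonneg fun _ _ => tokBridge_nonneg (M.gamBar_succ_le hk) (M.gamBar_le_one hk.le) _
    (M.xDen_nonneg _ _ _) _

lemma xReverse_le_one {k : ℕ} (hk : k < T) (z : State S V d) (x : TokSeq S V) :
    M.xReverse (k + 1) z x ≤ 1 :=
  Finset.prod_le_one (fun _ _ => tokBridge_nonneg (M.gamBar_succ_le hk) (M.gamBar_le_one hk.le) _
    (M.xDen_nonneg _ _ _) _) fun _ _ => tokBridge_le_one (M.gamBar_succ_le hk)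
      (M.gamBar_le_one hk.le) _ (M.xDen_nonneg _ _ _) (M.xDen_sum _ _ _) _

lemma yReverse_one (z : State S V d) (y : Latent d) :
    M.yReverse 1 z y = gaussDensity (M.yDen 1 z) (M.sigmaLat ^ 2) y := by simp [yReverse]

lemma yReverse_succ {k : ℕ} (hk : 1 ≤ k) (z : State S V d) (y : Latent d) :
    M.yReverse (k + 1) z y =
      gaussDensity (M.bridgeMean (k + 1) z.2 (M.yDen (k + 1) z)) (M.bridgeVar (k + 1)) y := by
  simp [yReverse, show k ≠ 0 by omega]

lemma yReverse_nonneg {k : ℕ} (hk : k < T) (z : State S V d) (y : Latent d) :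
    0 ≤ M.yReverse (k + 1) z y := by
  rcases Nat.eq_zero_or_pos k with rfl | h
  · rw [yReverse_one]; exact gaussDensity_nonneg _ M.sigmaLat_sq_pos _
  · rw [yReverse_succ _ h]; exact gaussDensity_nonneg _ (M.bridgeVar_pos h hk) _

/-- The density of `Z_k` given `Z_{k+1} = w` under the generative process. -/
def revStep (k : ℕ) (w u : State S V d) : ℝ≥0∞ :=
  ENNReal.ofReal (M.xReverse (k + 1) w u.1 * M.yReverse (k + 1) w u.2)

lemma measurable_revStep (k : ℕ) :
    Measurable fun p : State S V d × State S V d => M.revStep k p.1 p.2 := by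
  unfold revStep; fun_prop

/-- Masked tokens occur only at times at which masking has started. -/
def Reachable (k : ℕ) (w : State S V d) : Prop := ∀ i, w.1 i = mask V → M.gamBar k < 1

/-- At a masked token with γ̄_{k+1} = 1 the reverse token weights are all 0/0 = 0, so normalization
holds only on reachable states. -/
lemma lintegral_revStep {k : ℕ} (hk : k < T) {w : State S V d} (hw : M.Reachable (k + 1) w) :
    ∫⁻ u, M.revStep k w u ∂(Measure.count.prod volume) = 1 := by
  have hs : ∑ x, M.xReverse (k + 1) w x = 1 :=
    sum_prod_eq_one fun i => sum_tokBridge (M.xDen_sum _ _ _) (hw i)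
  unfold revStep
  rcases Nat.eq_zero_or_pos k with rfl | h
  · simp_rw [zero_add, yReverse_one]
    exact lintegral_mul_gauss (M.xReverse_nonneg hk w) hs M.sigmaLat_sq_pos
  · simp_rw [M.yReverse_succ h]
    exact lintegral_mul_gauss (M.xReverse_nonneg hk w) hs (M.bridgeVar_pos h hk)

/-- If γ̄_k = 1, a reverse step cannot end in a mask: its weight 1 - γ̄_k is zero, the denoiser
gives the mask no mass, and unmasked tokens stay put. The reverse chain thus never meets a
degenerate kernel. -/
lemma reachable_of_revStep_ne_zero {k : ℕ} (hk : k < T) {w u : State S V d}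
    (h : M.revStep k w u ≠ 0) : M.Reachable k u := by
  intro i hi
  refine lt_of_le_of_ne (M.gamBar_le_one hk.le) fun h1 => h ?_
  have : M.xReverse (k + 1) w u.1 = 0 := by
    refine Finset.prod_eq_zero (Finset.mem_univ i) ?_
    rw [Nat.add_sub_cancel, h1, hi]
    by_cases hw : w.1 i = mask V
    · simp [tokBridge, hw, M.xDen_mask]
    · simp [tokBridge, hw, oneHot, Ne.symm hw]
  simp [revStep, this]

/-- The density of the generative path. -/
def modelDensity (z : Path S V d T) : ℝ :=
  (if (z (Fin.last T)).1 = (fun _ => mask V) then 1 else 0) *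
    gaussDensity 0 (M.sigmaBarSq T) (z (Fin.last T)).2 *
    ∏ k : Fin T, (M.xReverse (k + 1) (z k.succ) (z k.castSucc).1 *
      M.yReverse (k + 1) (z k.succ) (z k.castSucc).2)

lemma modelLaw_eq : M.modelLaw =
    (pathRef S V d T).withDensity fun z => ENNReal.ofReal (M.modelDensity z) := rfl

lemma revStep_nonneg (z : Path S V d T) (k : Fin T) :
    0 ≤ M.xReverse (k + 1) (z k.succ) (z k.castSucc).1 *
      M.yReverse (k + 1) (z k.succ) (z k.castSucc).2 :=
  mul_nonneg (M.xReverse_nonneg k.2 _ _) (M.yReverse_nonneg k.2 _ _)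

lemma modelInit_nonneg (z : State S V d) :
    0 ≤ (if z.1 = (fun _ => mask V) then 1 else 0) * gaussDensity 0 (M.sigmaBarSq T) z.2 :=
  mul_nonneg (by split_ifs <;> simp)
    (gaussDensity_nonneg _ (M.sigmaBarSq_pos M.one_le_horizon le_rfl) _)

lemma modelDensity_nonneg (z : Path S V d T) : 0 ≤ M.modelDensity z :=
  mul_nonneg (M.modelInit_nonneg _) (Finset.prod_nonneg fun k _ => M.revStep_nonneg z k)

/-- The density of `Z_T` under the generative process. -/
def modelInit (w : State S V d) : ℝ≥0∞ :=
  ENNReal.ofReal ((if w.1 = (fun _ => mask V) then 1 else 0) *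
    gaussDensity 0 (M.sigmaBarSq T) w.2)

lemma ofReal_modelDensity (z : Path S V d T) : ENNReal.ofReal (M.modelDensity z) =
    M.modelInit (z (Fin.last T)) * pathProd (fun k u w => M.revStep k w u) T z := by
  rw [modelDensity, ENNReal.ofReal_mul (M.modelInit_nonneg _),
    ENNReal.ofReal_prod_of_nonneg fun k _ => M.revStep_nonneg z k]
  rfl

lemma measurable_ite_mask {α : Type*} [MeasurableSpace α] {x : α → TokSeq S V}
    (hx : Measurable x) : Measurable fun a => if x a = (fun _ => mask V) then (1 : ℝ) else 0 :=
  (measurable_of_countable fun x => if x = (fun _ => mask V) then (1 : ℝ) else 0).comp hx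

lemma measurable_modelDensity : Measurable M.modelDensity := by
  unfold modelDensity
  have := measurable_ite_mask (x := fun z : Path S V d T => (z (Fin.last T)).1) (by fun_prop)
  fun_prop

instance : IsProbabilityMeasure M.modelLaw := by
  constructor
  have hp : ∀ x : TokSeq S V, (0 : ℝ) ≤ if x = (fun _ => mask V) then 1 else 0 := fun x => by
    split_ifs <;> simp
  rw [modelLaw_eq, withDensity_apply _ MeasurableSet.univ, Measure.restrict_univ]
  simp_rw [ofReal_modelDensity]
  refine (lintegral_path_backward M.measurable_revStep M.Reachable
    (fun k hk w _ u h => M.reachable_of_revStep_ne_zero hk h)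
    (fun k hk w hw => M.lintegral_revStep hk hw) ?_ ?_).trans ?_
  · have := measurable_ite_mask (x := fun z : State S V d => z.1) (by fun_prop)
    unfold modelInit
    fun_prop
  · intro w _ i _
    -- At the starting time T every state is reachable because γ̄_T = 0.
    rw [gamBar_last]; exact zero_lt_one
  · exact lintegral_mul_gauss hp (by simp) (M.sigmaBarSq_pos M.one_le_horizon le_rfl)

/-! ### Densities along a path -/

lemma fwdDensity_eq_range (x₀ : TokSeq S V) (z : Path S V d T) : M.fwdDensity x₀ z =
    (if (at_ z 0).1 = x₀ then 1 else 0) * M.encoder (at_ z 0).1 (at_ z 0).2 *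
      ∏ k ∈ Finset.range T, (M.xForward (k + 1) (at_ z k).1 (at_ z (k + 1)).1 *
        M.yForward (k + 1) (at_ z k).2 (at_ z (k + 1)).2) := by
  rw [fwdDensity, ← Fin.prod_univ_eq_prod_range (fun k =>
    M.xForward (k + 1) (at_ z k).1 (at_ z (k + 1)).1 *
        M.yForward (k + 1) (at_ z k).2 (at_ z (k + 1)).2)]
  simp only [at_castSucc, at_succ]
  rfl

lemma modelDensity_eq_range (z : Path S V d T) : M.modelDensity z =
    (if (at_ z T).1 = (fun _ => mask V) then 1 else 0) *
      gaussDensity 0 (M.sigmaBarSq T) (at_ z T).2 *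
      ∏ k ∈ Finset.range T, (M.xReverse (k + 1) (at_ z (k + 1)) (at_ z k).1 *
        M.yReverse (k + 1) (at_ z (k + 1)) (at_ z k).2) := by
  rw [modelDensity, ← Fin.prod_univ_eq_prod_range (fun k =>
    M.xReverse (k + 1) (at_ z (k + 1)) (at_ z k).1 *
        M.yReverse (k + 1) (at_ z (k + 1)) (at_ z k).2)]
  have : z (Fin.last T) = at_ z T := (at_eq z (by omega)).symm
  simp only [at_castSucc, at_succ, this]

/-- A telescoping use of Bayes' rule: each further step trades (law at time n) · (forward step) for
(law at time n + 1) · (bridge). The bridges begin at time 1, since time 0 is conditioned upon. -/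
lemma prod_forward_eq {z : ℕ → State S V d} (hz : ∀ i, (z 0).1 i ≠ mask V) {n : ℕ} (hn : n < T) :
    ∏ k ∈ Finset.range (n + 1), (M.xForward (k + 1) (z k).1 (z (k + 1)).1 *
        M.yForward (k + 1) (z k).2 (z (k + 1)).2) =
      M.xMulti (n + 1) (z 0).1 (z (n + 1)).1 * M.yMulti (n + 1) (z 0).2 (z (n + 1)).2 *
        ∏ k ∈ Finset.Ico 1 (n + 1), (M.xBridge k (z 0).1 (z (k + 1)).1 (z k).1 *
          M.yBridge k (z 0).2 (z (k + 1)).2 (z k).2) := by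
  induction n with
  | zero => simp [xMulti_one, yMulti_one]
  | succ n ih =>
    rw [Finset.prod_range_succ, ih (by omega), Finset.prod_Ico_succ_top (show 1 ≤ n + 1 by omega)]
    have h1 := M.xBridge_bayes hn hz (z (n + 1)).1 (z (n + 1 + 1)).1
    have h2 := M.yBridge_bayes (t := n + 1) (by omega) hn (z 0).2 (z (n + 1)).2 (z (n + 1 + 1)).2
    generalize ∏ k ∈ Finset.Ico 1 (n + 1), (M.xBridge k (z 0).1 (z (k + 1)).1 (z k).1 *
      M.yBridge k (z 0).2 (z (k + 1)).2 (z k).2) = P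
    linear_combination P * M.yMulti (n + 1) (z 0).2 (z (n + 1)).2 *
        M.yForward (n + 1 + 1) (z (n + 1)).2 (z (n + 1 + 1)).2 * h1 +
      P * M.xMulti (n + 1 + 1) (z 0).1 (z (n + 1 + 1)).1 *
        M.xBridge (n + 1) (z 0).1 (z (n + 1 + 1)).1 (z (n + 1)).1 * h2

/-- Squared distance of the latent `u` to the bridge mean, in units of twice the variance. -/
def bridgeDist (k : ℕ) (y₀ y u : Latent d) : ℝ :=
  ‖u - M.bridgeMean (k + 1) y y₀‖ ^ 2 / (2 * M.bridgeVar (k + 1))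

/-- The probability that the denoiser unmasks the tokens `x₀` at the positions that are masked in
`w` but not in `u`. -/
def unmaskProb (k : ℕ) (x₀ : TokSeq S V) (w : State S V d) (u : TokSeq S V) : ℝ :=
  ∏ i, if w.1 i = mask V ∧ u i ≠ mask V then M.xDen (k + 1) w i (x₀ i) else 1

/-- The negative exponent of the forward density, up to constants. -/
def fwdExponent (x₀ : TokSeq S V) (z : Path S V d T) : ℝ :=
  ‖(at_ z 0).2 - M.encMean x₀‖ ^ 2 / (2 * M.sigmaLat ^ 2) +
    ‖(at_ z T).2 - M.alphaBar T • (at_ z 0).2‖ ^ 2 / (2 * M.sigmaBarSq T) +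
    ∑ k ∈ Finset.Ico 1 T, M.bridgeDist k (at_ z 0).2 (at_ z (k + 1)).2 (at_ z k).2

/-- The model density, up to the constants and the token transitions of the forward density. -/
def modelFactor (x₀ : TokSeq S V) (z : Path S V d T) : ℝ :=
  Real.exp (-(‖(at_ z 0).2 - M.yDen 1 (at_ z 1)‖ ^ 2 / (2 * M.sigmaLat ^ 2))) *
    Real.exp (-(‖(at_ z T).2‖ ^ 2 / (2 * M.sigmaBarSq T))) *
    M.xReverse 1 (at_ z 1) (at_ z 0).1 *
    ∏ k ∈ Finset.Ico 1 T,
      (Real.exp (-M.bridgeDist k (M.yDen (k + 1) (at_ z (k + 1))) (at_ z (k + 1)).2 (at_ z k).2) *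
        M.unmaskProb k x₀ (at_ z (k + 1)) (at_ z k).1)

lemma xReverse_eq_mul {k : ℕ} {x₀ : TokSeq S V} (hx₀ : ∀ i, x₀ i ≠ mask V) (w : State S V d)
    {u : TokSeq S V} (h : M.xBridge k x₀ w.1 u ≠ 0) :
    M.xReverse (k + 1) w u = M.xBridge k x₀ w.1 u * M.unmaskProb k x₀ w u := by
  rw [xReverse, xBridge, unmaskProb, ← Finset.prod_mul_distrib]
  exact Finset.prod_congr rfl fun i _ => tokBridge_eq_mul (hx₀ i) (M.xDen_mask _ _ _)
    (Finset.prod_ne_zero_iff.1 h i (Finset.mem_univ i))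

lemma yReverse_eq_mul {k : ℕ} (hk : 1 ≤ k) (y₀ : Latent d) (w : State S V d) (u : Latent d) :
    M.yReverse (k + 1) w u = M.yBridge k y₀ w.2 u * Real.exp (M.bridgeDist k y₀ w.2 u) *
      Real.exp (-M.bridgeDist k (M.yDen (k + 1) w) w.2 u) := by
  rw [yReverse_succ _ hk]
  exact gaussDensity_eq_mul_exp _ _ _ _

/-- Reverse factors are matched with the factors of the backward form of the forward density,
Gaussians of equal variance with each other. The last token step `xReverse 1` has no forward
partner, X_0 being fixed, and stays whole inside Φ. -/
lemma modelDensity_eq_mul {x₀ : TokSeq S V} (hx₀ : ∀ i, x₀ i ≠ mask V) {z : Path S V d T}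
    (hz : M.fwdDensity x₀ z ≠ 0) : M.modelDensity z =
      M.fwdDensity x₀ z * Real.exp (M.fwdExponent x₀ z) * M.modelFactor x₀ z := by
  have hT := M.one_le_horizon
  obtain ⟨n, hn⟩ : ∃ n, T = n + 1 := ⟨T - 1, by omega⟩
  have h0 : (at_ z 0).1 = x₀ := by
    by_contra h; rw [fwdDensity_eq_range] at hz; simp [h] at hz
  have hprod : ∏ k ∈ Finset.range T, (M.xForward (k + 1) (at_ z k).1 (at_ z (k + 1)).1 *
        M.yForward (k + 1) (at_ z k).2 (at_ z (k + 1)).2) =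
      M.xMulti T x₀ (at_ z T).1 * M.yMulti T (at_ z 0).2 (at_ z T).2 *
        ∏ k ∈ Finset.Ico 1 T, (M.xBridge k x₀ (at_ z (k + 1)).1 (at_ z k).1 *
          M.yBridge k (at_ z 0).2 (at_ z (k + 1)).2 (at_ z k).2) := by
    have := M.prod_forward_eq (z := at_ z) (by rwa [h0]) (n := n) (by omega)
    rwa [← hn, h0] at this
  have hf := M.fwdDensity_eq_range x₀ z
  rw [hprod, if_pos h0, one_mul] at hf
  rw [hf] at hz
  have hx : M.xMulti T x₀ (at_ z T).1 ≠ 0 := fun h => hz (by simp [h])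
  have hb : ∀ k ∈ Finset.Ico 1 T, M.xBridge k x₀ (at_ z (k + 1)).1 (at_ z k).1 ≠ 0 := by
    intro k hk h
    refine hz ?_
    rw [Finset.prod_eq_zero hk (by simp [h]), mul_zero, mul_zero]
  -- Since γ̄_T = 0, a nonzero forward density forces an all-mask X_T, so the indicator in the model
  -- density is 1.
  have hm : (at_ z T).1 = fun _ => mask V := by
    by_contra h; rw [xMulti_last, if_neg h] at hx; exact hx rfl
  rw [hf, M.xMulti_last, if_pos hm, one_mul, modelDensity_eq_range, if_pos hm, one_mul,
    Finset.range_eq_Ico, Finset.prod_eq_prod_Ico_succ_bot (by omega), zero_add, yReverse_one,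
    gaussDensity_eq_mul_exp (M.encMean x₀) (M.yDen 1 (at_ z 1)),
    gaussDensity_eq_mul_exp (M.alphaBar T • (at_ z 0).2) 0, sub_zero]
  have hk : ∀ k ∈ Finset.Ico 1 T, M.xReverse (k + 1) (at_ z (k + 1)) (at_ z k).1 *
        M.yReverse (k + 1) (at_ z (k + 1)) (at_ z k).2 =
      (M.xBridge k x₀ (at_ z (k + 1)).1 (at_ z k).1 *
          M.yBridge k (at_ z 0).2 (at_ z (k + 1)).2 (at_ z k).2) *
        Real.exp (M.bridgeDist k (at_ z 0).2 (at_ z (k + 1)).2 (at_ z k).2) *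
        (Real.exp (-M.bridgeDist k (M.yDen (k + 1) (at_ z (k + 1))) (at_ z (k + 1)).2 (at_ z k).2) *
        M.unmaskProb k x₀ (at_ z (k + 1)) (at_ z k).1) := by
    intro k hk
    rw [M.xReverse_eq_mul hx₀ _ (hb k hk),
      M.yReverse_eq_mul (Finset.mem_Ico.1 hk).1 (at_ z 0).2]
    ring
  rw [Finset.prod_congr rfl hk, Finset.prod_mul_distrib, Finset.prod_mul_distrib, ← Real.exp_sum,
    fwdExponent, modelFactor, Real.exp_add, Real.exp_add, encoder, yMulti, h0]
  ring

lemma bridgeDist_nonneg {k : ℕ} (h1 : 1 ≤ k) (hk : k < T) (y₀ y u : Latent d) :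
    0 ≤ M.bridgeDist k y₀ y u := by
  have := M.bridgeVar_pos h1 hk
  unfold bridgeDist; positivity

lemma unmaskProb_nonneg (k : ℕ) (x₀ : TokSeq S V) (w : State S V d) (u : TokSeq S V) :
    0 ≤ M.unmaskProb k x₀ w u :=
  Finset.prod_nonneg fun i _ => by split_ifs <;> simp [M.xDen_nonneg]

lemma unmaskProb_le_one (k : ℕ) (x₀ : TokSeq S V) (w : State S V d) (u : TokSeq S V) :
    M.unmaskProb k x₀ w u ≤ 1 :=
  Finset.prod_le_one (fun i _ => by split_ifs <;> simp [M.xDen_nonneg]) fun i _ => by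
    split_ifs <;> simp [M.xDen_le_one]

lemma negLog_unmaskProb (k : ℕ) (x₀ : TokSeq S V) (w : State S V d) (u : TokSeq S V) :
    negLog (M.unmaskProb k x₀ w u) =
      ∑ i, if w.1 i = mask V ∧ u i ≠ mask V then negLog (M.xDen (k + 1) w i (x₀ i)) else 0 := by
  rw [unmaskProb, negLog_prod _ _ (fun i _ => by split_ifs <;> simp [M.xDen_nonneg])
    fun i _ => by split_ifs <;> simp [M.xDen_le_one]]
  refine Finset.sum_congr rfl fun i _ => ?_
  split_ifs <;> simp [negLog_one]

lemma negLog_predProb (t : ℕ) (z : State S V d) (x : TokSeq S V) :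
    negLog (M.predProb t z x) = ∑ i, negLog (M.xDen t z i (x i)) :=
  negLog_prod _ _ (fun _ _ => M.xDen_nonneg _ _ _ _) fun _ _ => M.xDen_le_one _ _ _ _

@[fun_prop]
lemma measurable_bridgeDist_comp {α : Type*} [MeasurableSpace α] (k : ℕ)
    {y₀ y u : α → Latent d} (hy₀ : Measurable y₀) (hy : Measurable y) (hu : Measurable u) :
    Measurable fun a => M.bridgeDist k (y₀ a) (y a) (u a) := by
  unfold bridgeDist; fun_prop

@[fun_prop]
lemma measurable_unmaskProb_comp {α : Type*} [MeasurableSpace α] (k : ℕ) (x₀ : TokSeq S V)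
    {w : α → State S V d} {u : α → TokSeq S V} (hw : Measurable w) (hu : Measurable u) :
    Measurable fun a => M.unmaskProb k x₀ (w a) (u a) := by
  unfold unmaskProb
  refine Finset.measurable_prod _ fun i _ => Measurable.ite ?_ ?_ measurable_const
  · have h1 : Measurable fun a => (w a).1 i := by fun_prop
    have h2 : Measurable fun a => u a i := by fun_prop
    exact (h1 (measurableSet_singleton _)).inter (h2 (measurableSet_singleton _)).compl
  · exact (M.xDen_measurable _ _ _).comp hw

lemma measurable_fwdExponent (x₀ : TokSeq S V) : Measurable (M.fwdExponent x₀) := by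
  unfold fwdExponent; fun_prop

lemma measurable_modelFactor (x₀ : TokSeq S V) : Measurable (M.modelFactor x₀) := by
  unfold modelFactor; fun_prop

lemma fwdExponent_nonneg (x₀ : TokSeq S V) (z : Path S V d T) : 0 ≤ M.fwdExponent x₀ z := by
  have := M.sigmaBarSq_nonneg T
  refine add_nonneg (by positivity) (Finset.sum_nonneg fun k hk => ?_)
  rw [Finset.mem_Ico] at hk
  exact M.bridgeDist_nonneg hk.1 hk.2 _ _ _

lemma exp_neg_le_one {x : ℝ} (hx : 0 ≤ x) : Real.exp (-x) ≤ 1 :=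
  Real.exp_le_one_iff.2 (neg_nonpos.2 hx)

lemma modelFactor_nonneg (x₀ : TokSeq S V) (z : Path S V d T) : 0 ≤ M.modelFactor x₀ z := by
  have h1 := M.xReverse_nonneg (k := 0) M.one_le_horizon (at_ z 1) (at_ z 0).1
  refine mul_nonneg (by positivity) (Finset.prod_nonneg fun k _ => ?_)
  exact mul_nonneg (by positivity) (M.unmaskProb_nonneg _ _ _ _)

lemma negLog_modelFactor (x₀ : TokSeq S V) (z : Path S V d T) : negLog (M.modelFactor x₀ z) =
    ENNReal.ofReal (‖(at_ z 0).2 - M.yDen 1 (at_ z 1)‖ ^ 2 / (2 * M.sigmaLat ^ 2)) +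
    ENNReal.ofReal (‖(at_ z T).2‖ ^ 2 / (2 * M.sigmaBarSq T)) +
    negLog (M.xReverse 1 (at_ z 1) (at_ z 0).1) +
    ∑ k ∈ Finset.Ico 1 T,
      (ENNReal.ofReal (M.bridgeDist k (M.yDen (k + 1) (at_ z (k + 1))) (at_ z (k + 1)).2
          (at_ z k).2) +
        negLog (M.unmaskProb k x₀ (at_ z (k + 1)) (at_ z k).1)) := by
  have hs := M.sigmaBarSq_nonneg T
  have e1 : (0 : ℝ) ≤ ‖(at_ z 0).2 - M.yDen 1 (at_ z 1)‖ ^ 2 / (2 * M.sigmaLat ^ 2) := by positivity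
  have e2 : (0 : ℝ) ≤ ‖(at_ z T).2‖ ^ 2 / (2 * M.sigmaBarSq T) := by positivity
  have e3 : ∀ k ∈ Finset.Ico 1 T, Real.exp (-M.bridgeDist k (M.yDen (k + 1) (at_ z (k + 1)))
      (at_ z (k + 1)).2 (at_ z k).2) ≤ 1 := fun k hk =>
    exp_neg_le_one (M.bridgeDist_nonneg (Finset.mem_Ico.1 hk).1 (Finset.mem_Ico.1 hk).2 _ _ _)
  have x0 := M.xReverse_nonneg (k := 0) M.one_le_horizon (at_ z 1) (at_ z 0).1
  have x1 := M.xReverse_le_one (k := 0) M.one_le_horizon (at_ z 1) (at_ z 0).1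
  have p0 : ∀ k ∈ Finset.Ico 1 T, 0 ≤ (Real.exp (-M.bridgeDist k (M.yDen (k + 1) (at_ z (k + 1)))
      (at_ z (k + 1)).2 (at_ z k).2) * M.unmaskProb k x₀ (at_ z (k + 1)) (at_ z k).1) := fun k _ =>
    mul_nonneg (by positivity) (M.unmaskProb_nonneg _ _ _ _)
  have p1 : ∀ k ∈ Finset.Ico 1 T, (Real.exp (-M.bridgeDist k (M.yDen (k + 1) (at_ z (k + 1)))
      (at_ z (k + 1)).2 (at_ z k).2) * M.unmaskProb k x₀ (at_ z (k + 1)) (at_ z k).1) ≤ 1 :=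
    fun k hk => mul_le_one₀ (e3 k hk) (M.unmaskProb_nonneg _ _ _ _) (M.unmaskProb_le_one _ _ _ _)
  have q := mul_le_one₀ (exp_neg_le_one e1) (Real.exp_pos _).le (exp_neg_le_one e2)
  rw [modelFactor, negLog_mul (by positivity) (mul_le_one₀ q x0 x1) (Finset.prod_nonneg p0)
    (Finset.prod_le_one p0 p1), negLog_mul (by positivity) q x0 x1,
    negLog_mul (Real.exp_pos _).le (exp_neg_le_one e1) (Real.exp_pos _).le (exp_neg_le_one e2),
    negLog_prod _ _ p0 p1, negLog_exp_neg, negLog_exp_neg]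
  congr 1
  refine Finset.sum_congr rfl fun k hk => ?_
  rw [negLog_mul (Real.exp_pos _).le (e3 k hk) (M.unmaskProb_nonneg _ _ _ _)
    (M.unmaskProb_le_one _ _ _ _), negLog_exp_neg]

lemma modelFactor_le_one (x₀ : TokSeq S V) (z : Path S V d T) : M.modelFactor x₀ z ≤ 1 := by
  have hs := M.sigmaBarSq_nonneg T
  have e1 : (0 : ℝ) ≤ ‖(at_ z 0).2 - M.yDen 1 (at_ z 1)‖ ^ 2 / (2 * M.sigmaLat ^ 2) := by positivity
  have e2 : (0 : ℝ) ≤ ‖(at_ z T).2‖ ^ 2 / (2 * M.sigmaBarSq T) := by positivity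
  have x0 := M.xReverse_nonneg (k := 0) M.one_le_horizon (at_ z 1) (at_ z 0).1
  have x1 := M.xReverse_le_one (k := 0) M.one_le_horizon (at_ z 1) (at_ z 0).1
  have p0 : ∀ k ∈ Finset.Ico 1 T, 0 ≤ (Real.exp (-M.bridgeDist k (M.yDen (k + 1) (at_ z (k + 1)))
      (at_ z (k + 1)).2 (at_ z k).2) * M.unmaskProb k x₀ (at_ z (k + 1)) (at_ z k).1) := fun k _ =>
    mul_nonneg (by positivity) (M.unmaskProb_nonneg _ _ _ _)
  refine mul_le_one₀ (mul_le_one₀ (mul_le_one₀ (exp_neg_le_one e1) (Real.exp_pos _).le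
    (exp_neg_le_one e2)) x0 x1) (Finset.prod_nonneg p0) (Finset.prod_le_one p0 fun k hk => ?_)
  rw [Finset.mem_Ico] at hk
  exact mul_le_one₀ (exp_neg_le_one (M.bridgeDist_nonneg hk.1 hk.2 _ _ _))
    (M.unmaskProb_nonneg _ _ _ _) (M.unmaskProb_le_one _ _ _ _)

/-! ### Conditional expectations under the forward process -/

lemma lintegral_mul_gauss_mul {p : TokSeq S V → ℝ} (hp : ∀ x, 0 ≤ p x) (m : Latent d) (v : ℝ)
    {h : State S V d → ℝ≥0∞} (hh : Measurable h) :
    ∫⁻ z : State S V d, ENNReal.ofReal (p z.1 * gaussDensity m v z.2) * h z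
      ∂(Measure.count.prod volume) =
    ∑ x, ENNReal.ofReal (p x) * ∫⁻ y, ENNReal.ofReal (gaussDensity m v y) * h (x, y) := by
  have hpm : Measurable fun z : State S V d => p z.1 :=
    (measurable_of_countable p).comp measurable_fst
  rw [lintegral_state (by fun_prop)]
  refine Finset.sum_congr rfl fun x _ => ?_
  rw [← lintegral_const_mul _ (by fun_prop)]
  refine lintegral_congr fun y => ?_
  rw [ENNReal.ofReal_mul (hp x), mul_assoc]

/-- Mean squared distance to a point, for a product of a token law and a Gaussian law. -/
lemma lintegral_mul_gauss_sq {p : TokSeq S V → ℝ} (hp : ∀ x, 0 ≤ p x) (hp1 : ∑ x, p x = 1)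
    (m c : Latent d) {v : ℝ} (hv : 0 < v) :
    ∫⁻ z : State S V d, ENNReal.ofReal (p z.1 * gaussDensity m v z.2) *
        ENNReal.ofReal (‖z.2 - c‖ ^ 2 / (2 * v)) ∂(Measure.count.prod volume) =
      ENNReal.ofReal (d / 2) + ENNReal.ofReal (‖m - c‖ ^ 2 / (2 * v)) := by
  rw [lintegral_mul_gauss_mul hp m v (h := fun z => ENNReal.ofReal (‖z.2 - c‖ ^ 2 / (2 * v)))
    (by fun_prop)]
  simp_rw [lintegral_gaussDensity_mul_sq m c hv]
  rw [← Finset.sum_mul, ← ENNReal.ofReal_sum_of_nonneg fun x _ => hp x, hp1, ENNReal.ofReal_one,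
    one_mul]

lemma lintegral_encoder_sq (x₀ : TokSeq S V) :
    ∫⁻ z, ENNReal.ofReal (‖(at_ z 0).2 - M.encMean x₀‖ ^ 2 / (2 * M.sigmaLat ^ 2))
      ∂M.condForwardLaw x₀ = ENNReal.ofReal (d / 2) := by
  rw [M.lintegral_condForwardLaw_init x₀
    (h := fun z => ENNReal.ofReal (‖z.2 - M.encMean x₀‖ ^ 2 / (2 * M.sigmaLat ^ 2))) (by fun_prop)]
  refine Eq.trans (lintegral_congr fun z => ?_) ((lintegral_mul_gauss_sq
    (p := fun x => if x = x₀ then 1 else 0) (fun x => by split_ifs <;> simp) (by simp)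
    (M.encMean x₀) (M.encMean x₀) M.sigmaLat_sq_pos).trans (by simp))
  congr 1
  unfold fwdInit encoder
  split_ifs with h <;> simp [h]

/-- Used with two centres `c`: the forward mean ᾱ_T Y_0, where the excess vanishes, and the prior
mean 0, where the excess is L^Y_T. -/
lemma lintegral_last_sq {x₀ : TokSeq S V} (hx₀ : ∀ i, x₀ i ≠ mask V)
    {c : Latent d → Latent d} (hc : Measurable c) :
    ∫⁻ z, ENNReal.ofReal (‖(at_ z T).2 - c (at_ z 0).2‖ ^ 2 / (2 * M.sigmaBarSq T))
      ∂M.condForwardLaw x₀ = ENNReal.ofReal (d / 2) +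
      ∫⁻ z, ENNReal.ofReal (‖M.alphaBar T • (at_ z 0).2 - c (at_ z 0).2‖ ^ 2 /
        (2 * M.sigmaBarSq T)) ∂M.condForwardLaw x₀ := by
  have hT := M.one_le_horizon
  have hs := M.sigmaBarSq_pos hT le_rfl
  obtain ⟨n, hn⟩ : ∃ n, T = n + 1 := ⟨T - 1, by omega⟩
  have h1 := M.lintegral_condForwardLaw_pair hx₀ (n := n) (by omega)
    (h := fun z₀ w => ENNReal.ofReal (‖w.2 - c z₀.2‖ ^ 2 / (2 * M.sigmaBarSq T))) (by fun_prop)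
  rw [← hn] at h1
  have h2 : ∀ g : State S V d → ℝ≥0∞, Measurable g → ENNReal.ofReal (d / 2) +
      ∫⁻ z, g (at_ z 0) ∂M.condForwardLaw x₀ =
      ∫⁻ z, ENNReal.ofReal (d / 2) + g (at_ z 0) ∂M.condForwardLaw x₀ := fun g hg => by
    rw [lintegral_add_left measurable_const, lintegral_const, measure_univ, mul_one]
  rw [h1, h2 (fun z => ENNReal.ofReal (‖M.alphaBar T • z.2 - c z.2‖ ^ 2 /
        (2 * M.sigmaBarSq T))) (by fun_prop), M.lintegral_condForwardLaw_init x₀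
        (h := fun z => ENNReal.ofReal (d / 2) + ENNReal.ofReal (‖M.alphaBar T • z.2 - c z.2‖ ^ 2 /
        (2 * M.sigmaBarSq T))) (by fun_prop)]
  refine lintegral_congr fun z₀ => ?_
  congr 1
  exact lintegral_mul_gauss_sq (M.xMulti_nonneg le_rfl _)
    (sum_prod_eq_one fun _ => sum_tokForward _ _) (M.alphaBar T • z₀.2) (c z₀.2) hs

/-- The origin of λ^Y: the two means differ only through the coefficient of the clean latent, and
λ^Y is its square over twice the bridge variance. -/
lemma bridgeMean_dist {k : ℕ} (h1 : 1 ≤ k) (hk : k < T) (y y₀ y₁ : Latent d) :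
    ‖M.bridgeMean (k + 1) y y₀ - M.bridgeMean (k + 1) y y₁‖ ^ 2 / (2 * M.bridgeVar (k + 1)) =
      M.weightY (k + 1) * ‖y₀ - y₁‖ ^ 2 := by
  have a1 := M.sigmaBarSq_pos h1 hk.le
  have a2 := M.sigmaBarSq_pos (t := k + 1) (by omega) hk
  have a3 := M.sigma_pos (k + 1) (by omega) hk
  have : M.bridgeMean (k + 1) y y₀ - M.bridgeMean (k + 1) y y₁ =
      (M.alphaBar k * M.sigma (k + 1) ^ 2 / M.sigmaBarSq (k + 1)) • (y₀ - y₁) := by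
    simp only [bridgeMean, Nat.add_sub_cancel]; module
  rw [this, norm_smul, mul_pow, Real.norm_eq_abs, sq_abs, bridgeVar, weightY, Nat.add_sub_cancel]
  field_simp

/-- Expected squared distance of a latent to the bridge with a different clean latent. -/
lemma lintegral_bridgeDist {x₀ : TokSeq S V} (hx₀ : ∀ i, x₀ i ≠ mask V) {k : ℕ} (h1 : 1 ≤ k)
    (hk : k < T) {c : State S V d → State S V d → Latent d}
    (hc : Measurable fun p : State S V d × State S V d => c p.1 p.2) :
    ∫⁻ z, ENNReal.ofReal (M.bridgeDist k (c (at_ z 0) (at_ z (k + 1))) (at_ z (k + 1)).2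
        (at_ z k).2) ∂M.condForwardLaw x₀ = ENNReal.ofReal (d / 2) +
      ∫⁻ z, ENNReal.ofReal (M.weightY (k + 1) *
        ‖(at_ z 0).2 - c (at_ z 0) (at_ z (k + 1))‖ ^ 2) ∂M.condForwardLaw x₀ := by
  obtain ⟨n, rfl⟩ : ∃ n, k = n + 1 := ⟨k - 1, by omega⟩
  have hcc : Measurable fun p : State S V d × State S V d × State S V d => c p.1 p.2.2 :=
    hc.comp (f := fun p : State S V d × State S V d × State S V d => (p.1, p.2.2)) (by fun_prop)
  have hz : Measurable fun z : Path S V d T => c (at_ z 0) (at_ z (n + 1 + 1)) :=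
    hc.comp (f := fun z : Path S V d T => (at_ z 0, at_ z (n + 1 + 1))) (by fun_prop)
  have := M.lintegral_condForwardLaw_bridge hx₀ hk
    (h := fun z₀ u w => ENNReal.ofReal (M.bridgeDist (n + 1) (c z₀ w) w.2 u.2))
    (g := fun z₀ w => ENNReal.ofReal (d / 2) + ENNReal.ofReal (M.weightY (n + 1 + 1) *
        ‖z₀.2 - c z₀ w‖ ^ 2)) (by fun_prop) (by fun_prop) ?_
  · refine this.trans ?_
    rw [lintegral_add_left measurable_const, lintegral_const, measure_univ, mul_one]
  · intro z₀ w hz₀ hw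
    rw [← M.bridgeMean_dist h1 hk w.2]
    exact lintegral_mul_gauss_sq (M.xBridge_nonneg hk _ _)
      (M.sum_xBridge hk (hz₀ ▸ hx₀) hw) _ _ (M.bridgeVar_pos h1 hk)

/-- Expected contribution of the tokens that get unmasked. -/
lemma sum_xBridge_negLog {k : ℕ} (hk : k < T) {x₀ : TokSeq S V}
    (hx₀ : ∀ i, x₀ i ≠ mask V) {w : State S V d} (hw : M.xMulti (k + 1) x₀ w.1 ≠ 0) :
    ∑ u, ENNReal.ofReal (M.xBridge k x₀ w.1 u) * negLog (M.unmaskProb k x₀ w u) =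
      ENNReal.ofReal (-M.weightX (k + 1)) *
        ∑ i, if w.1 i = mask V then negLog (M.xDen (k + 1) w i (x₀ i)) else 0 := by
  have hn : ∀ i v, 0 ≤ tokBridge (M.gamBar k) (M.gamBar (k + 1)) (w.1 i) (oneHot (x₀ i)) v :=
    fun i => tokBridge_nonneg (M.gamBar_succ_le hk) (M.gamBar_le_one hk.le) _ (oneHot_nonneg _)
  simp_rw [negLog_unmaskProb, xBridge, ENNReal.ofReal_prod_of_nonneg fun i _ => hn i _]
  rw [sum_prod_mul_sum (p := fun i v => ENNReal.ofReal
      (tokBridge (M.gamBar k) (M.gamBar (k + 1)) (w.1 i) (oneHot (x₀ i)) v))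
    (φ := fun i v => if w.1 i = mask V ∧ v ≠ mask V then
      negLog (M.xDen (k + 1) w i (x₀ i)) else 0), Finset.mul_sum]
  · refine Finset.sum_congr rfl fun i _ => ?_
    -- The unmasking probability (γ̄_k - γ̄_{k+1}) / (1 - γ̄_{k+1}) is -λ^X at time k + 1.
    rw [sum_tokBridge_mul_ofReal (hx₀ i), mul_ite, mul_zero, weightX, Nat.add_sub_cancel, ← neg_div,
      neg_sub]
  · intro i
    rw [← ENNReal.ofReal_sum_of_nonneg fun v _ => hn i v, sum_tokBridge (sum_oneHot _) fun hi =>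
      M.gamBar_lt_one_of_xMulti_ne_zero (t := k + 1) hk hx₀ hw hi, ENNReal.ofReal_one]

/-- The conditional expectation `g` is prescribed only at reachable w. It can be the sum over masked
positions, as for the inequality, or the full cross-entropy, which agrees with it on reachable
states under carry-over. -/
lemma lintegral_unmaskProb {x₀ : TokSeq S V} (hx₀ : ∀ i, x₀ i ≠ mask V) {k : ℕ} (h1 : 1 ≤ k)
    (hk : k < T) {g : State S V d → ℝ≥0∞} (hg : Measurable g)
    (hgs : ∀ w : State S V d, M.xMulti (k + 1) x₀ w.1 ≠ 0 → ENNReal.ofReal (-M.weightX (k + 1)) *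
        (∑ i, if w.1 i = mask V then negLog (M.xDen (k + 1) w i (x₀ i)) else 0) = g w) :
    ∫⁻ z, negLog (M.unmaskProb k x₀ (at_ z (k + 1)) (at_ z k).1) ∂M.condForwardLaw x₀ =
      ∫⁻ z, g (at_ z (k + 1)) ∂M.condForwardLaw x₀ := by
  obtain ⟨n, rfl⟩ : ∃ n, k = n + 1 := ⟨k - 1, by omega⟩
  refine M.lintegral_condForwardLaw_bridge hx₀ hk
    (h := fun z₀ u w => negLog (M.unmaskProb (n + 1) x₀ w u.1))
    (g := fun _ w => g w) (by fun_prop) (by fun_prop) ?_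
  rintro z₀ w rfl hw
  rw [← hgs w hw, ← M.sum_xBridge_negLog hk hx₀ hw]
  refine (lintegral_mul_gauss_mul (M.xBridge_nonneg hk _ _) _ _
    (h := fun u => negLog (M.unmaskProb (n + 1) z₀.1 w u.1)) (by fun_prop)).trans ?_
  refine Finset.sum_congr rfl fun u _ => ?_
  dsimp only
  rw [lintegral_mul_const _ (by fun_prop), lintegral_gaussDensity _ (M.bridgeVar_pos h1 hk),
    one_mul]

lemma measurable_unmaskSum (k : ℕ) (x₀ : TokSeq S V) : Measurable fun w : State S V d =>
    ENNReal.ofReal (-M.weightX (k + 1)) *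
      ∑ i, if w.1 i = mask V then negLog (M.xDen (k + 1) w i (x₀ i)) else 0 := by
  refine Measurable.const_mul (Finset.measurable_sum _ fun i _ => ?_) _
  have h1 : Measurable fun w : State S V d => w.1 i := by fun_prop
  exact Measurable.ite (h1 (measurableSet_singleton _))
    (M.xDen_measurable _ _ _).negLog measurable_const

/-- The only loss in the second inequality: positions already unmasked contribute nothing on the
left and a nonnegative cross-entropy on the right. -/
lemma lintegral_unmaskProb_le {x₀ : TokSeq S V} (hx₀ : ∀ i, x₀ i ≠ mask V) {k : ℕ} (h1 : 1 ≤ k)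
    (hk : k < T) :
    ∫⁻ z, negLog (M.unmaskProb k x₀ (at_ z (k + 1)) (at_ z k).1) ∂M.condForwardLaw x₀ ≤
      ∫⁻ z, ENNReal.ofReal (-M.weightX (k + 1)) * negLog (M.predProb (k + 1) (at_ z (k + 1)) x₀)
        ∂M.condForwardLaw x₀ := by
  rw [M.lintegral_unmaskProb hx₀ h1 hk (M.measurable_unmaskSum k x₀) fun _ _ => rfl]
  refine lintegral_mono fun z => ?_
  simp only [negLog_predProb]
  gcongr with i
  split_ifs <;> simp

lemma eq_of_xMulti_ne_zero {t : ℕ} {x₀ x : TokSeq S V} (h : M.xMulti t x₀ x ≠ 0) {i : Fin S}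
    (hi : x i ≠ mask V) : x i = x₀ i := by
  have := Finset.prod_ne_zero_iff.1 h i (Finset.mem_univ i)
  by_contra hne
  refine this ?_
  unfold tokForward
  split_ifs <;> simp [oneHot, hi, hne]

/-- The forward process only masks, so an unmasked token is still the clean one; a denoiser that
copies it gives it probability 1, and the extra terms are -log 1 = 0. -/
lemma lintegral_unmaskProb_eq (hM : M.CarryOver) {x₀ : TokSeq S V} (hx₀ : ∀ i, x₀ i ≠ mask V)
    {k : ℕ} (h1 : 1 ≤ k) (hk : k < T) :
    ∫⁻ z, negLog (M.unmaskProb k x₀ (at_ z (k + 1)) (at_ z k).1) ∂M.condForwardLaw x₀ =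
      ∫⁻ z, ENNReal.ofReal (-M.weightX (k + 1)) * negLog (M.predProb (k + 1) (at_ z (k + 1)) x₀)
        ∂M.condForwardLaw x₀ := by
  refine M.lintegral_unmaskProb hx₀ h1 hk (g := fun w => ENNReal.ofReal (-M.weightX (k + 1)) *
    negLog (M.predProb (k + 1) w x₀)) (by fun_prop) fun w hw => ?_
  rw [negLog_predProb]
  congr 1
  refine Finset.sum_congr rfl fun i _ => ?_
  split_ifs with hi
  · rfl
  · rw [hM (k + 1) (by omega) hk w i hi, M.eq_of_xMulti_ne_zero hw hi, oneHot_self, negLog_one]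

/-! ### The divergence of the forward path from the generative path -/

/-- Each of the T + 1 terms is a Gaussian distance to its own mean. The finiteness of the total is
what `klDiv_withDensity_add` requires of N. -/
lemma lintegral_fwdExponent {x₀ : TokSeq S V} (hx₀ : ∀ i, x₀ i ≠ mask V) :
    ∫⁻ z, ENNReal.ofReal (M.fwdExponent x₀ z) ∂M.condForwardLaw x₀ =
      ENNReal.ofReal (d / 2) + ENNReal.ofReal (d / 2) +
        ∑ _k ∈ Finset.Ico 1 T, ENNReal.ofReal (d / 2) := by
  have hs := M.sigmaBarSq_nonneg T
  have hb : ∀ z : Path S V d T, ∀ k ∈ Finset.Ico 1 T,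
      0 ≤ M.bridgeDist k (at_ z 0).2 (at_ z (k + 1)).2 (at_ z k).2 := fun z k hk =>
    M.bridgeDist_nonneg (Finset.mem_Ico.1 hk).1 (Finset.mem_Ico.1 hk).2 _ _ _
  have hsplit : ∀ z : Path S V d T, ENNReal.ofReal (M.fwdExponent x₀ z) =
      ENNReal.ofReal (‖(at_ z 0).2 - M.encMean x₀‖ ^ 2 / (2 * M.sigmaLat ^ 2)) +
        ENNReal.ofReal (‖(at_ z T).2 - M.alphaBar T • (at_ z 0).2‖ ^ 2 / (2 * M.sigmaBarSq T)) +
      ∑ k ∈ Finset.Ico 1 T,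
        ENNReal.ofReal (M.bridgeDist k (at_ z 0).2 (at_ z (k + 1)).2 (at_ z k).2) := fun z => by
    rw [fwdExponent, ENNReal.ofReal_add (by positivity) (Finset.sum_nonneg (hb z)),
      ENNReal.ofReal_add (by positivity) (by positivity), ENNReal.ofReal_sum_of_nonneg (hb z)]
  simp_rw [hsplit]
  rw [lintegral_add_left (by fun_prop), lintegral_finsetSum _ fun k _ => by fun_prop]
  congr 1
  · rw [lintegral_add_left (by fun_prop), M.lintegral_encoder_sq,
      M.lintegral_last_sq hx₀ (c := fun y => M.alphaBar T • y) (by fun_prop)]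
    simp
  · refine Finset.sum_congr rfl fun k hk => ?_
    rw [Finset.mem_Ico] at hk
    refine (M.lintegral_bridgeDist hx₀ hk.1 hk.2 (c := fun z₀ _ => z₀.2) (by fun_prop)).trans ?_
    simp

instance : SigmaFinite (pathRef S V d T) := by
  unfold pathRef; infer_instance

/-- The exact divergence. There are T + 1 terms d/2 in E[N] but only T in E[-log Φ]: the last
reverse step is left as a raw squared error, without a bias-variance split, so one d/2 stays on the
left. -/
lemma klDiv_add_dim {x₀ : TokSeq S V} (hx₀ : ∀ i, x₀ i ≠ mask V) :
    InformationTheory.klDiv (M.condForwardLaw x₀) M.modelLaw + ENNReal.ofReal (d / 2) =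
      ∫⁻ z, ENNReal.ofReal (‖(at_ z 0).2 - M.yDen 1 (at_ z 1)‖ ^ 2 / (2 * M.sigmaLat ^ 2))
        ∂M.condForwardLaw x₀ +
      ∫⁻ z, ENNReal.ofReal (‖M.alphaBar T • (at_ z 0).2‖ ^ 2 / (2 * M.sigmaBarSq T))
        ∂M.condForwardLaw x₀ +
      ∫⁻ z, negLog (M.xReverse 1 (at_ z 1) (at_ z 0).1) ∂M.condForwardLaw x₀ +
      ∑ k ∈ Finset.Ico 1 T,
        (∫⁻ z, ENNReal.ofReal (M.weightY (k + 1) *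
            ‖(at_ z 0).2 - M.yDen (k + 1) (at_ z (k + 1))‖ ^ 2) ∂M.condForwardLaw x₀ +
        ∫⁻ z, negLog (M.unmaskProb k x₀ (at_ z (k + 1)) (at_ z k).1) ∂M.condForwardLaw x₀) := by
  have hN := M.lintegral_fwdExponent hx₀
  set e := ENNReal.ofReal ((d : ℝ) / 2) with he
  have hefin : e ≠ ∞ := by simp [he]
  have hsfin : e + ∑ _k ∈ Finset.Ico 1 T, e ≠ ∞ :=
    ENNReal.add_ne_top.2 ⟨hefin, ENNReal.sum_ne_top.2 fun _ _ => hefin⟩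
  have : IsProbabilityMeasure
      ((pathRef S V d T).withDensity fun z => ENNReal.ofReal (M.fwdDensity x₀ z)) :=
    inferInstanceAs (IsProbabilityMeasure (M.condForwardLaw x₀))
  have : IsProbabilityMeasure
      ((pathRef S V d T).withDensity fun z => ENNReal.ofReal (M.modelDensity z)) :=
    inferInstanceAs (IsProbabilityMeasure M.modelLaw)
  have hkl := klDiv_withDensity_add (pathRef S V d T) (M.measurable_fwdDensity x₀)
    M.measurable_modelDensity (M.measurable_fwdExponent x₀) (M.measurable_modelFactor x₀)
    (M.fwdDensity_nonneg x₀) M.modelDensity_nonneg (M.fwdExponent_nonneg x₀)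
    (M.modelFactor_nonneg x₀) (fun z _ => M.modelFactor_le_one x₀ z)
    (by rw [← condForwardLaw_eq, hN, add_assoc]; exact ENNReal.add_ne_top.2 ⟨hefin, hsfin⟩)
    fun z hz => M.modelDensity_eq_mul hx₀ hz
  rw [← condForwardLaw_eq, ← modelLaw_eq, hN] at hkl
  simp_rw [negLog_modelFactor] at hkl
  rw [lintegral_add_left (by fun_prop), lintegral_add_left (by fun_prop),
    lintegral_add_left (by fun_prop), lintegral_finsetSum _ fun k _ => by fun_prop] at hkl
  have hlast := M.lintegral_last_sq hx₀ (c := fun _ => 0) measurable_const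
  simp only [sub_zero] at hlast
  rw [hlast] at hkl
  have hsum : ∀ k ∈ Finset.Ico 1 T, ∫⁻ z, (ENNReal.ofReal (M.bridgeDist k
      (M.yDen (k + 1) (at_ z (k + 1))) (at_ z (k + 1)).2 (at_ z k).2) +
        negLog (M.unmaskProb k x₀ (at_ z (k + 1)) (at_ z k).1)) ∂M.condForwardLaw x₀ = e +
      (∫⁻ z, ENNReal.ofReal (M.weightY (k + 1) *
          ‖(at_ z 0).2 - M.yDen (k + 1) (at_ z (k + 1))‖ ^ 2) ∂M.condForwardLaw x₀ +
        ∫⁻ z, negLog (M.unmaskProb k x₀ (at_ z (k + 1)) (at_ z k).1) ∂M.condForwardLaw x₀) := by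
    intro k hk
    rw [Finset.mem_Ico] at hk
    rw [lintegral_add_left (by fun_prop), M.lintegral_bridgeDist hx₀ hk.1 hk.2
      (c := fun _ w => M.yDen (k + 1) w) (by fun_prop), add_assoc]
  rw [Finset.sum_congr rfl hsum, Finset.sum_add_distrib] at hkl
  -- The T common terms d/2 are finite, so they may be cancelled in [0, ∞].
  refine (ENNReal.add_right_inj hsfin).1 (Eq.trans ?_ (hkl.trans ?_)) <;> ring

end Model

lemma coe_ennreal_sum {ι : Type*} (s : Finset ι) (φ : ι → ℝ≥0∞) :
    ((∑ i ∈ s, φ i : ℝ≥0∞) : EReal) = ∑ i ∈ s, (φ i : EReal) := by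
  classical
  induction s using Finset.induction_on with
  | empty => simp
  | insert a s ha ih => rw [Finset.sum_insert ha, Finset.sum_insert ha, EReal.coe_ennreal_add, ih]

namespace Model

variable {S V d T : ℕ} (M : Model S V d T)

/-! ### Data points that contain a mask token -/

lemma ae_condForwardLaw_of_fwdDensity {x₀ : TokSeq S V} {p : Path S V d T → Prop}
    (h : ∀ z, M.fwdDensity x₀ z ≠ 0 → p z) : ∀ᵐ z ∂M.condForwardLaw x₀, p z := by
  rw [condForwardLaw_eq, ae_withDensity_iff (M.measurable_fwdDensity x₀).ennreal_ofReal]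
  exact ae_of_all _ fun z hz => h z fun h0 => hz (by simp [h0])

lemma fst_eq_of_fwdDensity_ne_zero {x₀ : TokSeq S V} {z : Path S V d T}
    (hz : M.fwdDensity x₀ z ≠ 0) : (at_ z 0).1 = x₀ := by
  by_contra h
  rw [fwdDensity_eq_range] at hz
  simp [h] at hz

lemma ae_condForwardLaw_fst (x₀ : TokSeq S V) : ∀ᵐ z ∂M.condForwardLaw x₀, (at_ z 0).1 = x₀ :=
  M.ae_condForwardLaw_of_fwdDensity fun _ => M.fst_eq_of_fwdDensity_ne_zero

/-- The generative process cannot produce the mask token. -/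
lemma xReverse_one_eq_zero {x₀ : TokSeq S V} {i : Fin S} (hi : x₀ i = mask V) {z : Path S V d T}
    (hz : M.fwdDensity x₀ z ≠ 0) : M.xReverse 1 (at_ z 1) (at_ z 0).1 = 0 := by
  have h0 := M.fst_eq_of_fwdDensity_ne_zero hz
  rw [fwdDensity_eq_range] at hz
  have h1 := Finset.prod_ne_zero_iff.1 (right_ne_zero_of_mul hz) 0
    (Finset.mem_range.2 M.one_le_horizon)
  have h2 := Finset.prod_ne_zero_iff.1 (left_ne_zero_of_mul h1) i (Finset.mem_univ i)
  rw [h0, hi, zero_add] at h2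
  -- Masks are absorbing, so position i is also masked at time 1; unmasking it back to a mask has
  -- weight (1 - γ̄_0) plus a multiple of the zero mask coordinate, hence zero.
  have h3 : (at_ z 1).1 i = mask V := by
    by_contra h
    simp [tokForward, oneHot, h] at h2
  refine Finset.prod_eq_zero (Finset.mem_univ i) ?_
  simp [tokBridge, h0, hi, h3, gamBar_zero, M.xDen_mask]

lemma klDiv_eq_top {x₀ : TokSeq S V} {i : Fin S} (hi : x₀ i = mask V) :
    InformationTheory.klDiv (M.condForwardLaw x₀) M.modelLaw = ∞ := by
  have : IsProbabilityMeasure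
      ((pathRef S V d T).withDensity fun z => ENNReal.ofReal (M.fwdDensity x₀ z)) :=
    inferInstanceAs (IsProbabilityMeasure (M.condForwardLaw x₀))
  have : IsProbabilityMeasure
      ((pathRef S V d T).withDensity fun z => ENNReal.ofReal (M.modelDensity z)) :=
    inferInstanceAs (IsProbabilityMeasure M.modelLaw)
  -- The model density vanishes on the support of the forward density, so N = 0 and Φ = 0 are
  -- admissible and the divergence is the integral of the constant ∞.
  have hkl := klDiv_withDensity_add (pathRef S V d T) (M.measurable_fwdDensity x₀)
    M.measurable_modelDensity (N := fun _ => 0) (Φ := fun _ => 0) measurable_const measurable_const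
    (M.fwdDensity_nonneg x₀) M.modelDensity_nonneg (fun _ => le_rfl) (fun _ => le_rfl)
    (fun _ _ => zero_le_one) (by simp) fun z hz => by
      rw [modelDensity_eq_range, Finset.prod_eq_zero (Finset.mem_range.2 M.one_le_horizon)]
      · simp
      · simp [M.xReverse_one_eq_zero hi hz]
  rw [← condForwardLaw_eq, ← modelLaw_eq] at hkl
  simpa [negLog_zero] using hkl

lemma lintegral_xReverse_eq_top {x₀ : TokSeq S V} {i : Fin S} (hi : x₀ i = mask V) :
    ∫⁻ z, negLog (M.xReverse 1 (at_ z 1) (at_ z 0).1) ∂M.condForwardLaw x₀ = ∞ := by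
  have : ∀ᵐ z ∂M.condForwardLaw x₀, negLog (M.xReverse 1 (at_ z 1) (at_ z 0).1) = ∞ :=
    M.ae_condForwardLaw_of_fwdDensity fun z hz => by
      rw [M.xReverse_one_eq_zero hi hz, negLog_zero]
  rw [lintegral_congr_ae this]
  simp

/-! ### The objective -/

/-- The contribution of the data point `x₀` to the objective, without the constant `-d / 2`. -/
def condLoss (x₀ : TokSeq S V) : ℝ≥0∞ :=
  ∫⁻ z, ENNReal.ofReal (‖M.alphaBar T • (at_ z 0).2‖ ^ 2 / (2 * M.sigmaBarSq T))
    ∂M.condForwardLaw x₀ +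
  ∫⁻ z, negLog (M.xReverse 1 (at_ z 1) (at_ z 0).1) ∂M.condForwardLaw x₀ +
  ∫⁻ z, ENNReal.ofReal (‖(at_ z 0).2 - M.yDen 1 (at_ z 1)‖ ^ 2 / (2 * M.sigmaLat ^ 2))
    ∂M.condForwardLaw x₀ +
  ∑ t ∈ Finset.Icc 2 T,
    (∫⁻ z, ((M.weightX t : EReal) * ENNReal.log (ENNReal.ofReal
        (M.predProb t (at_ z t) (at_ z 0).1))).toENNReal ∂M.condForwardLaw x₀ +
      ∫⁻ z, ENNReal.ofReal (M.weightY t * ‖(at_ z 0).2 - M.yDen t (at_ z t)‖ ^ 2)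
        ∂M.condForwardLaw x₀)

lemma sum_Icc_two (φ : ℕ → ℝ≥0∞) :
    ∑ t ∈ Finset.Icc 2 T, φ t = ∑ k ∈ Finset.Ico 1 T, φ (k + 1) := by
  rw [Finset.sum_Ico_add' φ 1 T 1]
  rfl

lemma lintegral_weightX (x₀ : TokSeq S V) {k : ℕ} (hk : k < T) :
    ∫⁻ z, ((M.weightX (k + 1) : EReal) * ENNReal.log (ENNReal.ofReal
        (M.predProb (k + 1) (at_ z (k + 1)) (at_ z 0).1))).toENNReal ∂M.condForwardLaw x₀ =
      ∫⁻ z, ENNReal.ofReal (-M.weightX (k + 1)) * negLog (M.predProb (k + 1) (at_ z (k + 1)) x₀)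
        ∂M.condForwardLaw x₀ := by
  refine lintegral_congr_ae ?_
  filter_upwards [M.ae_condForwardLaw_fst x₀] with z hz
  rw [hz, toENNReal_mul_log (M.weightX_nonpos hk)]

lemma condLoss_eq_top {x₀ : TokSeq S V} {i : Fin S} (hi : x₀ i = mask V) : M.condLoss x₀ = ∞ := by
  simp [condLoss, M.lintegral_xReverse_eq_top hi]

lemma klDiv_add_dim_le (x₀ : TokSeq S V) :
    InformationTheory.klDiv (M.condForwardLaw x₀) M.modelLaw + ENNReal.ofReal (d / 2) ≤
      M.condLoss x₀ := by
  by_cases hx₀ : ∀ i, x₀ i ≠ mask V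
  swap
  · push Not at hx₀
    obtain ⟨i, hi⟩ := hx₀
    rw [M.condLoss_eq_top hi]
    exact le_top
  rw [M.klDiv_add_dim hx₀, condLoss, sum_Icc_two]
  refine add_le_add (le_of_eq (by ring)) (Finset.sum_le_sum fun k hk => ?_)
  rw [Finset.mem_Ico] at hk
  rw [add_comm, M.lintegral_weightX x₀ hk.2]
  exact add_le_add (M.lintegral_unmaskProb_le hx₀ hk.1 hk.2) le_rfl

/-- Data points with a mask need no carry-over: the divergence and the L^X_0 part are both infinite.
-/
lemma klDiv_add_dim_eq (hM : M.CarryOver) (x₀ : TokSeq S V) :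
    InformationTheory.klDiv (M.condForwardLaw x₀) M.modelLaw + ENNReal.ofReal (d / 2) =
      M.condLoss x₀ := by
  by_cases hx₀ : ∀ i, x₀ i ≠ mask V
  swap
  · push Not at hx₀
    obtain ⟨i, hi⟩ := hx₀
    rw [M.condLoss_eq_top hi, M.klDiv_eq_top hi, top_add]
  rw [M.klDiv_add_dim hx₀, condLoss, sum_Icc_two]
  congr 1
  · ring
  · refine Finset.sum_congr rfl fun k hk => ?_
    rw [Finset.mem_Ico] at hk
    rw [add_comm, M.lintegral_weightX x₀ hk.2, M.lintegral_unmaskProb_eq hM hx₀ hk.1 hk.2]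

lemma sum_data : ∑ x₀, M.data x₀ = 1 := by
  rw [← tsum_fintype (L := .unconditional _)]; exact M.data.tsum_coe

lemma lintegral_forwardLaw (h : Path S V d T → ℝ≥0∞) :
    ∫⁻ z, h z ∂M.forwardLaw = ∑ x₀, M.data x₀ * ∫⁻ z, h z ∂M.condForwardLaw x₀ := by
  simp [forwardLaw, lintegral_finsetSum_measure, lintegral_smul_measure]

lemma negELBO_add : M.negELBO + ENNReal.ofReal (d / 2) = ∑ x₀, M.data x₀ *
    (InformationTheory.klDiv (M.condForwardLaw x₀) M.modelLaw + ENNReal.ofReal (d / 2)) := by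
  simp_rw [mul_add, Finset.sum_add_distrib, ← Finset.sum_mul, sum_data, one_mul]
  rfl

/-- All nonnegative terms are gathered in [0, ∞], leaving one subtraction of a finite constant in
the extended reals. -/
lemma loss_eq : M.loss = ((∑ x₀, M.data x₀ * M.condLoss x₀ : ℝ≥0∞) : EReal) -
    ((d / 2 : ℝ) : EReal) := by
  have h : ∑ x₀, M.data x₀ * M.condLoss x₀ = M.lossYT + M.lossX0 +
      (∫⁻ z, ENNReal.ofReal (‖(at_ z 0).2 - M.yDen 1 (at_ z 1)‖ ^ 2 / (2 * M.sigmaLat ^ 2))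
        ∂M.forwardLaw) + ∑ t ∈ Finset.Icc 2 T, (M.lossX t + M.lossY t) := by
    have hx : M.lossX0 = ∫⁻ z, negLog (M.xReverse 1 (at_ z 1) (at_ z 0).1) ∂M.forwardLaw := rfl
    rw [lossYT_eq, hx]
    simp only [lossX, lossY, lintegral_forwardLaw, condLoss, mul_add, Finset.mul_sum,
      Finset.sum_add_distrib]
    rw [Finset.sum_comm (s := Finset.Icc 2 T), Finset.sum_comm (s := Finset.Icc 2 T)]
  rw [h, loss, lossXT_eq_zero, lossZ0]
  have hsum : ((∑ t ∈ Finset.Icc 2 T, (M.lossX t + M.lossY t) : ℝ≥0∞) : EReal) =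
      ∑ t ∈ Finset.Icc 2 T, ((M.lossX t : EReal) + (M.lossY t : EReal)) := by
    simp [coe_ennreal_sum]
  simp only [EReal.coe_ennreal_add, hsum, EReal.coe_ennreal_zero, zero_add, sub_eq_add_neg]
  rw [← add_assoc, add_right_comm]

lemma coe_ofReal_dim : ((ENNReal.ofReal ((d : ℝ) / 2) : ℝ≥0∞) : EReal) = ((d / 2 : ℝ) : EReal) := by
  rw [EReal.coe_ennreal_ofReal, max_eq_left (by positivity)]

/-- The data processing bound is averaged over x₀; it holds for every x₀, also those of zero
probability or containing masks. -/
lemma negLogLik_le : M.negLogLik ≤ (M.negELBO : EReal) := by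
  rw [negELBO, coe_ennreal_sum, negLogLik]
  refine Finset.sum_le_sum fun x₀ _ => ?_
  rw [EReal.coe_ennreal_mul]
  refine mul_le_mul_of_nonneg_left ?_ (EReal.coe_ennreal_nonneg _)
  exact neg_log_measure_le_klDiv _ _ (g := fun z : Path S V d T => (z 0).1) (by fun_prop) x₀
    (M.ae_condForwardLaw_fst x₀)

end Model

end FujiLDDM

end

theorem proposition3 {S V d T : ℕ} (M : FujiLDDM.Model S V d T) :
    M.negLogLik ≤ (M.negELBO : EReal) ∧
    (M.negELBO : EReal) ≤ M.loss ∧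
    (M.CarryOver → (M.negELBO : EReal) = M.loss) := by
  -- Adding and subtracting the finite d/2 reduces both claims to comparisons in [0, ∞], one data
  -- point at a time.
  have h : (M.negELBO : EReal) = ((M.negELBO + ENNReal.ofReal (d / 2) : ENNReal) : EReal) -
      ((d / 2 : ℝ) : EReal) := by
    rw [EReal.coe_ennreal_add, FujiLDDM.Model.coe_ofReal_dim, EReal.add_sub_cancel_right]
  refine ⟨M.negLogLik_le, ?_, fun hM => ?_⟩
  · rw [h, M.negELBO_add, M.loss_eq]
    refine EReal.sub_le_sub (EReal.coe_ennreal_le_coe_ennreal_iff.2 ?_) le_rfl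
    exact Finset.sum_le_sum fun x₀ _ => by gcongr; exact M.klDiv_add_dim_le x₀
  · rw [h, M.negELBO_add, M.loss_eq]
    simp_rw [M.klDiv_add_dim_eq hM]
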